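/- Let $n,e,f\ge 0$ be integers and $G=GL(n,\mathbb C)$. Let $V_0=M_n(\mathbb C)^{\oplus e}$ and $V_1=M_n(\mathbb C)^{\oplus f}$, with $G$ acting by simultaneous conjugation, and let $$S=S_{e,f,n}=S(V_0^*)\otimes\textstyle\bigwedge V_1^*$$ (symmetric algebra tensor exterior algebra), a supercommutative superalgebra on which $G$ acts by the algebra automorphisms extending the contragredient action on $V_0^*\oplus V_1^*$. Let $G$ act diagonally on $M_n(S)=M_n(\mathbb C)\otimes S$ (conjugation on $M_n(\mathbb C)$). Let $\eta_i=(\eta^{(i)}_{h,k})\in M_n(S)$, $1\le i\le e$, be the bosonic generic matrices and $\xi_j=(\xi^{(j)}_{h,k})\in M_n(S)$, $1\le j\le f$, the fermionic generic matrices, where $\eta^{(i)}_{h,k}\in V_0^*$ (even) and $\xi^{(j)}_{h,k}\in V_1^*$ (odd) are the coordinate functions of the $i$-th, resp. $j$-th, matrix. Write $tr:M_n(S)\to S$ for the usual trace. For the free superalgebra $R=\mathbb C\langle X,Y\rangle$ in even variables $y_1,\dots,y_e$ and odd variables $x_1,\dots,x_f$, let $[R,R]_s$ be the span of the supercommutators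 $ab-(-1)^{d(a)d(b)}ba$ of homogeneous elements, and let $\mathcal T$ be the super symmetric algebra of the superspace $W=R/[R,R]_s$, that is $\mathcal T=S(W_0)\otimes\bigwedge W_1$; the class of $M\in R$ in $\mathcal T$ is denoted $t(M)$. The free superalgebra with trace is the graded tensor product $\mathcal F_T\langle X,Y\rangle=R\,\widehat\otimes\,\mathcal T$. The evaluation $ev:\mathcal F_T\langle X,Y\rangle\to M_n(S)$ is the homomorphism with $y_i\mapsto\eta_i$, $x_j\mapsto\xi_j$ and $t(M)\mapsto tr(ev(M))\cdot 1$; it restricts to a homomorphism $\mathcal T\to S$, $t(M)\mapsto tr(ev(M))$, where $S$ is identified with the scalar matrices. Theorem (FFT). The image of $ev$ is the algebra $\mathcal E_n=M_n(S)^G$ of equivariant maps, and the image of its restriction $\mathcal T\to S$ is the algebra $\mathcal T_n=S^G$ of invariants. That is: (1) the algebra $\mathcal T_n=S^G$ is generated, as a $\mathbb C$-algebra, by the elements $tr(M)$ for all monomials $M$ in the generic matrices $\eta_i,\xi_j$; (2) the algebra $\mathcal E_n=M_n(S)^G$ is generated, as a $\mathbb C$-algebra, by the elements $tr(M)\cdot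 1$ for all monomials $M$, together with the generic matrices $\eta_i,\xi_j$. -/

import Mathlib

open scoped TensorProduct DirectSum

noncomputable section

/-! ### Superalgebras over the complex numbers

A superspace is given by its even and odd parts; a superalgebra is a complex algebra `A` together
with a `ZMod 2`-grading `𝒜 : ZMod 2 → Submodule ℂ A`. -/

/-- The super symmetric algebra `𝕂(W) = S(W₀) ⊗ ⋀ W₁` of a superspace `W = W₀ ⊕ W₁`.
Since `S(W₀)` is purely even, this is the ordinary tensor product of algebras. -/
abbrev SuperSym (W₀ W₁ : Type*) [AddCommGroup W₀] [Module ℂ W₀] [AddCommGroup W₁] [Module ℂ W₁] :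
    Type _ :=
  SymmetricAlgebra ℂ W₀ ⊗[ℂ] ExteriorAlgebra ℂ W₁

namespace SuperSym

variable (W₀ W₁ : Type*) [AddCommGroup W₀] [Module ℂ W₀] [AddCommGroup W₁] [Module ℂ W₁]

/-- The parity grading of `𝕂(W)`: degree `i` is `S(W₀) ⊗ (⋀ W₁)ᵢ`, where `(⋀ W₁)₀` and `(⋀ W₁)₁`
are spanned by the products of an even, respectively odd, number of elements of `W₁`. -/
def grading (i : ZMod 2) : Submodule ℂ (SuperSym W₀ W₁) :=
  ((CliffordAlgebra.evenOdd (0 : QuadraticForm ℂ W₁) i).baseChange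
    (SymmetricAlgebra ℂ W₀)).restrictScalars ℂ

instance gradedAlgebra : GradedAlgebra (grading W₀ W₁) :=
  let G : GradedAlgebra fun i => (CliffordAlgebra.evenOdd (0 : QuadraticForm ℂ W₁) i).baseChange
    (SymmetricAlgebra ℂ W₀) := inferInstance
  { one_mem := G.one_mem
    mul_mem := fun _ _ _ _ ha hb => G.mul_mem ha hb
    decompose' := G.decompose'
    left_inv := G.left_inv
    right_inv := G.right_inv }

/-- The generators of degree `0`. -/
def ιEven : W₀ →ₗ[ℂ] SuperSym W₀ W₁ :=
  (Algebra.TensorProduct.includeLeft : SymmetricAlgebra ℂ W₀ →ₐ[ℂ] SuperSym W₀ W₁).toLinearMap ∘ₗ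
    SymmetricAlgebra.ι ℂ W₀

/-- The generators of degree `1`. -/
def ιOdd : W₁ →ₗ[ℂ] SuperSym W₀ W₁ :=
  (Algebra.TensorProduct.includeRight : ExteriorAlgebra ℂ W₁ →ₐ[ℂ] SuperSym W₀ W₁).toLinearMap ∘ₗ
    ExteriorAlgebra.ι ℂ

variable {W₀ W₁}

theorem ιEven_mem (w : W₀) : ιEven W₀ W₁ w ∈ grading W₀ W₁ 0 :=
  Submodule.tmul_mem_baseChange_of_mem _
    (SetLike.GradedOne.one_mem (A := CliffordAlgebra.evenOdd (0 : QuadraticForm ℂ W₁)))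

theorem ιOdd_mem (w : W₁) : ιOdd W₀ W₁ w ∈ grading W₀ W₁ 1 :=
  Submodule.tmul_mem_baseChange_of_mem _
    (CliffordAlgebra.ι_mem_evenOdd_one (0 : QuadraticForm ℂ W₁) w)

end SuperSym

/-- A superalgebra is supercommutative if `ab = (-1)^{d(a)d(b)} ba` for homogeneous `a`, `b`. -/
def IsSuperComm {A : Type*} [Ring A] [Algebra ℂ A] (𝒜 : ZMod 2 → Submodule ℂ A) : Prop :=
  ∀ ⦃i j : ZMod 2⦄ ⦃a b : A⦄, a ∈ 𝒜 i → b ∈ 𝒜 j → a * b = (-1 : ℤˣ) ^ (i * j) • (b * a)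

theorem SuperSym.isSuperComm (W₀ W₁ : Type*) [AddCommGroup W₀] [Module ℂ W₀]
    [AddCommGroup W₁] [Module ℂ W₁] : IsSuperComm (SuperSym.grading W₀ W₁) := by
  intro i j a b ha hb
  have hΛ : ∀ x ∈ CliffordAlgebra.evenOdd (0 : QuadraticForm ℂ W₁) i,
      ∀ y ∈ CliffordAlgebra.evenOdd (0 : QuadraticForm ℂ W₁) j,
      x * y = (-1 : ℤˣ) ^ (i * j) • (y * x) := by
    intro x hx y hy
    have := CliffordAlgebra.map_mul_map_of_isOrtho_of_mem_evenOdd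
      (QuadraticMap.Isometry.id (0 : QuadraticForm ℂ W₁))
      (QuadraticMap.Isometry.id (0 : QuadraticForm ℂ W₁)) (by intro x y; simp [QuadraticMap.IsOrtho])
      x y hx hy
    simpa [mul_comm j i] using this
  change a ∈ Submodule.baseChange _ _ at ha
  change b ∈ Submodule.baseChange _ _ at hb
  rw [Submodule.baseChange_eq_span] at ha hb
  induction ha using Submodule.span_induction with
  | zero => simp
  | add x y _ _ hx hy => rw [add_mul, mul_add, smul_add, hx, hy]
  | smul s x _ hx =>
    rw [smul_mul_assoc, mul_smul_comm, hx, smul_comm]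
  | mem x hx =>
    obtain ⟨x, hx, rfl⟩ := hx
    induction hb using Submodule.span_induction with
    | zero => simp
    | add x y _ _ hx hy => rw [add_mul, mul_add, smul_add, hx, hy]
    | smul s x _ hx =>
      rw [smul_mul_assoc, mul_smul_comm, hx, smul_comm]
    | mem y hy =>
      obtain ⟨y, hy, rfl⟩ := hy
      simp only [TensorProduct.mk_apply, Algebra.TensorProduct.tmul_mul_tmul, one_mul]
      rw [hΛ x hx y hy, Units.smul_def, Units.smul_def, ← Int.cast_smul_eq_zsmul ℂ,
        ← Int.cast_smul_eq_zsmul ℂ, TensorProduct.tmul_smul]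

namespace IsSuperComm

variable {A : Type*} [Ring A] [Algebra ℂ A] {𝒜 : ZMod 2 → Submodule ℂ A} [GradedAlgebra 𝒜]

theorem even_mem_center (h : IsSuperComm 𝒜) {a : A} (ha : a ∈ 𝒜 0) :
    a ∈ Subalgebra.center ℂ A := by
  rw [Subalgebra.mem_center_iff]
  intro b
  induction b using DirectSum.Decomposition.inductionOn 𝒜 with
  | zero => simp
  | homogeneous b => simpa using (h ha b.2).symm
  | add x y hx hy => rw [add_mul, mul_add, hx, hy]

theorem odd_mul_self {A : Type*} [Ring A] [Algebra ℂ A] {𝒜 : ZMod 2 → Submodule ℂ A}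
    (h : IsSuperComm 𝒜) {a : A} (ha : a ∈ 𝒜 1) : a * a = 0 := by
  have h1 : a * a = -(a * a) := by simpa using h ha ha
  have h2 : (2 : ℂ) • (a * a) = 0 := by
    rw [two_smul]
    nth_rewrite 1 [h1]
    simp
  simpa using h2

end IsSuperComm

namespace SuperSym

section Lift

variable {W₀ W₁ A : Type*} [AddCommGroup W₀] [Module ℂ W₀] [AddCommGroup W₁] [Module ℂ W₁]
  [Ring A] [Algebra ℂ A] {𝒜 : ZMod 2 → Submodule ℂ A} [GradedAlgebra 𝒜] (h : IsSuperComm 𝒜)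
  (φ₀ : W₀ →ₗ[ℂ] 𝒜 0) (φ₁ : W₁ →ₗ[ℂ] 𝒜 1)

/-- The extension of `φ₀` to `S(W₀)`; even elements of `A` are central. -/
def liftEven : SymmetricAlgebra ℂ W₀ →ₐ[ℂ] Subalgebra.center ℂ A :=
  SymmetricAlgebra.lift <|
    LinearMap.codRestrict (Subalgebra.toSubmodule (Subalgebra.center ℂ A))
      ((𝒜 0).subtype ∘ₗ φ₀) fun w => h.even_mem_center (φ₀ w).2

/-- The extension of `φ₁` to `⋀ W₁`; odd elements of `A` have square zero. -/
def liftOdd : ExteriorAlgebra ℂ W₁ →ₐ[ℂ] A :=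
  ExteriorAlgebra.lift ℂ ⟨(𝒜 1).subtype ∘ₗ φ₁, fun w => h.odd_mul_self (φ₁ w).2⟩

theorem lift_commute (s : SymmetricAlgebra ℂ W₀) (l : ExteriorAlgebra ℂ W₁) :
    Commute ((Subalgebra.center ℂ A).val.comp (liftEven h φ₀) s) (liftOdd h φ₁ l) :=
  ((Subalgebra.mem_center_iff.1 (liftEven h φ₀ s).2) _).symm

/-- The algebra homomorphism `𝕂(W) → A` into a supercommutative superalgebra that extends a graded
linear map `W₀ → A₀`, `W₁ → A₁`. -/
def lift : SuperSym W₀ W₁ →ₐ[ℂ] A :=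
  Algebra.TensorProduct.lift ((Subalgebra.center ℂ A).val.comp (liftEven h φ₀)) (liftOdd h φ₁)
    (lift_commute h φ₀ φ₁)

theorem lift_tmul (s : SymmetricAlgebra ℂ W₀) (l : ExteriorAlgebra ℂ W₁) :
    lift h φ₀ φ₁ (s ⊗ₜ l) = (liftEven h φ₀ s : A) * liftOdd h φ₁ l := rfl

theorem lift_ιEven (w : W₀) : lift h φ₀ φ₁ (ιEven W₀ W₁ w) = φ₀ w := by
  refine (lift_tmul h φ₀ φ₁ _ _).trans ?_
  rw [map_one, mul_one, liftEven, SymmetricAlgebra.lift_ι_apply]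
  rfl

theorem lift_ιOdd (w : W₁) : lift h φ₀ φ₁ (ιOdd W₀ W₁ w) = φ₁ w := by
  refine (lift_tmul h φ₀ φ₁ _ _).trans ?_
  rw [map_one, liftOdd, ExteriorAlgebra.lift_ι_apply]
  exact one_mul _

end Lift

end SuperSym

theorem SuperSym.lift_mem {W₀ W₁ A : Type*} [AddCommGroup W₀] [Module ℂ W₀] [AddCommGroup W₁]
    [Module ℂ W₁] [Ring A] [Algebra ℂ A] {𝒜 : ZMod 2 → Submodule ℂ A} [GradedAlgebra 𝒜]
    (h : IsSuperComm 𝒜) (φ₀ : W₀ →ₗ[ℂ] 𝒜 0) (φ₁ : W₁ →ₗ[ℂ] 𝒜 1) {i : ZMod 2}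
    {x : SuperSym W₀ W₁} (hx : x ∈ SuperSym.grading W₀ W₁ i) :
    SuperSym.lift h φ₀ φ₁ x ∈ 𝒜 i := by
  have hS : ∀ s : SymmetricAlgebra ℂ W₀, SuperSym.lift h φ₀ φ₁ (s ⊗ₜ 1) ∈ 𝒜 0 := by
    intro s
    induction s using SymmetricAlgebra.induction with
    | algebraMap r =>
      have : (algebraMap ℂ (SymmetricAlgebra ℂ W₀) r ⊗ₜ[ℂ] (1 : ExteriorAlgebra ℂ W₁)) =
        algebraMap ℂ (SuperSym W₀ W₁) r := rfl
      rw [this, AlgHom.commutes]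
      exact SetLike.algebraMap_mem_graded 𝒜 r
    | ι w => exact (SuperSym.lift_ιEven h φ₀ φ₁ w) ▸ (φ₀ w).2
    | mul a b ha hb =>
      have := SetLike.mul_mem_graded ha hb
      rw [← map_mul, Algebra.TensorProduct.tmul_mul_tmul] at this
      simpa using this
    | add a b ha hb => rw [TensorProduct.add_tmul, map_add]; exact add_mem ha hb
  have hΛ : ∀ y ∈ CliffordAlgebra.evenOdd (0 : QuadraticForm ℂ W₁) i,
      SuperSym.lift h φ₀ φ₁ (1 ⊗ₜ y) ∈ 𝒜 i := by
    intro y hy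
    have hι : ∀ w : W₁, SuperSym.lift h φ₀ φ₁ (1 ⊗ₜ CliffordAlgebra.ι 0 w) ∈ 𝒜 1 := fun w =>
      (SuperSym.lift_ιOdd h φ₀ φ₁ w) ▸ (φ₁ w).2
    induction y, hy using CliffordAlgebra.evenOdd_induction with
    | range_ι_pow v hv =>
      fin_cases i
      · obtain ⟨r, rfl⟩ : ∃ r, algebraMap ℂ (CliffordAlgebra (0 : QuadraticForm ℂ W₁)) r = v := by
          simpa [ZMod.val, Submodule.mem_one] using hv
        have : ((1 : SymmetricAlgebra ℂ W₀) ⊗ₜ[ℂ] algebraMap ℂ (ExteriorAlgebra ℂ W₁) r) =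
          algebraMap ℂ (SuperSym W₀ W₁) r := (Algebra.TensorProduct.algebraMap_apply' r).symm
        erw [this, AlgHom.commutes]
        exact SetLike.algebraMap_mem_graded 𝒜 r
      · obtain ⟨w, rfl⟩ : ∃ w, CliffordAlgebra.ι (0 : QuadraticForm ℂ W₁) w = v := by
          simpa [ZMod.val] using hv
        exact hι w
    | add x y hx hy h1 h2 => rw [TensorProduct.tmul_add, map_add]; exact add_mem h1 h2
    | ι_mul_ι_mul m₁ m₂ x hx ih =>
      have := SetLike.mul_mem_graded (SetLike.mul_mem_graded (hι m₁) (hι m₂)) ih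
      simp only [← map_mul, Algebra.TensorProduct.tmul_mul_tmul, one_mul] at this
      have e : (1 : ZMod 2) + 1 = 0 := rfl
      simpa [e] using this
  change x ∈ Submodule.baseChange _ _ at hx
  rw [Submodule.baseChange_eq_span] at hx
  induction hx using Submodule.span_induction with
  | zero => simp
  | add x y _ _ hx hy => rw [map_add]; exact add_mem hx hy
  | smul s x _ hx =>
    have := SetLike.mul_mem_graded (hS s) hx
    rw [← map_mul, zero_add] at this
    have e : s • x = (s ⊗ₜ 1) * x := Algebra.smul_def s x
    rwa [e]
  | mem x hx =>
    obtain ⟨x, hx, rfl⟩ := hx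
    exact hΛ x hx

section FreeTrace

variable {A : Type*} [Ring A] [Algebra ℂ A] (𝒜 : ZMod 2 → Submodule ℂ A)

/-- The span `[A, A]ₛ` of the supercommutators `ab - (-1)^{d(a)d(b)} ba` of homogeneous elements. -/
def superCommutators : Submodule ℂ A :=
  Submodule.span ℂ {x | ∃ i j : ZMod 2, ∃ a ∈ 𝒜 i, ∃ b ∈ 𝒜 j,
    x = a * b - (-1 : ℤˣ) ^ (i * j) • (b * a)}

/-- The degree `i` part of the graded quotient `A / [A, A]ₛ`. -/
abbrev SuperCyclic (i : ZMod 2) : Type _ :=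
  𝒜 i ⧸ (superCommutators 𝒜).comap (𝒜 i).subtype

/-- The algebra `𝕂(A / [A, A]ₛ)` of formal traces of a superalgebra `A`. -/
abbrev TraceAlg : Type _ := SuperSym (SuperCyclic 𝒜 0) (SuperCyclic 𝒜 1)

variable [GradedAlgebra 𝒜]

/-- The formal trace `t : A → 𝕂(A / [A, A]ₛ)`: the class of an element in
`A / [A, A]ₛ = (A / [A, A]ₛ)₀ ⊕ (A / [A, A]ₛ)₁`. -/
def formalTrace : A →ₗ[ℂ] TraceAlg 𝒜 :=
  SuperSym.ιEven _ _ ∘ₗ Submodule.mkQ _ ∘ₗ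
      DirectSum.component ℂ (ZMod 2) (fun i => 𝒜 i) 0 ∘ₗ
        (DirectSum.decomposeLinearEquiv 𝒜).toLinearMap +
    SuperSym.ιOdd _ _ ∘ₗ Submodule.mkQ _ ∘ₗ
      DirectSum.component ℂ (ZMod 2) (fun i => 𝒜 i) 1 ∘ₗ
        (DirectSum.decomposeLinearEquiv 𝒜).toLinearMap

/-- The superalgebra with trace `A_t = A ⊗̂ 𝕂(A / [A, A]ₛ)` freely generated by a superalgebra `A`;
the product is that of the graded tensor product. -/
abbrev WithTrace : Type _ :=
  GradedTensorProduct ℂ 𝒜 (SuperSym.grading (SuperCyclic 𝒜 0) (SuperCyclic 𝒜 1))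

/-- The inclusion of the trace algebra. -/
def WithTrace.ofTraceAlg : TraceAlg 𝒜 →ₐ[ℂ] WithTrace 𝒜 :=
  GradedTensorProduct.includeRight 𝒜 (SuperSym.grading (SuperCyclic 𝒜 0) (SuperCyclic 𝒜 1))

/-- The inclusion of the superalgebra `A` itself. -/
def WithTrace.of : A →ₐ[ℂ] WithTrace 𝒜 :=
  GradedTensorProduct.includeLeft 𝒜 (SuperSym.grading (SuperCyclic 𝒜 0) (SuperCyclic 𝒜 1))

/-- The trace operation of `A_t`, with values in the trace algebra: `t(a ⊗ c) = t(a) c`. -/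
def WithTrace.trace : WithTrace 𝒜 →ₗ[ℂ] TraceAlg 𝒜 :=
  LinearMap.mul' ℂ (TraceAlg 𝒜) ∘ₗ (formalTrace 𝒜).rTensor (TraceAlg 𝒜) ∘ₗ
    (GradedTensorProduct.of ℂ 𝒜
      (SuperSym.grading (SuperCyclic 𝒜 0) (SuperCyclic 𝒜 1))).symm.toLinearMap

end FreeTrace

/-! ### Evaluation in matrices over a supercommutative superalgebra -/

section Evaluation

variable {n : ℕ} {C : Type*} [Ring C] [Algebra ℂ C] {𝒞 : ZMod 2 → Submodule ℂ C} [GradedAlgebra 𝒞]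

theorem IsSuperComm.trace_mul {n : ℕ} {C : Type*} [Ring C] [Algebra ℂ C]
    {𝒞 : ZMod 2 → Submodule ℂ C} (hC : IsSuperComm 𝒞) {i j : ZMod 2}
    {P Q : Matrix (Fin n) (Fin n) C} (hP : ∀ h k, P h k ∈ 𝒞 i) (hQ : ∀ h k, Q h k ∈ 𝒞 j) :
    (P * Q).trace = (-1 : ℤˣ) ^ (i * j) • (Q * P).trace := by
  simp only [Matrix.trace, Matrix.diag, Matrix.mul_apply, Finset.smul_sum]
  rw [Finset.sum_comm]
  exact Finset.sum_congr rfl fun k _ => Finset.sum_congr rfl fun h _ => hC (hP h k) (hQ k h)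

variable {A : Type*} [Ring A] [Algebra ℂ A] {𝒜 : ZMod 2 → Submodule ℂ A}
  (hC : IsSuperComm 𝒞) (F : A →ₐ[ℂ] Matrix (Fin n) (Fin n) C)
  (hF : ∀ ⦃i : ZMod 2⦄ ⦃a : A⦄, a ∈ 𝒜 i → ∀ h k, F a h k ∈ 𝒞 i)

/-- The linear map `(A / [A, A]ₛ)ᵢ → Cᵢ`, `[a] ↦ tr(F(a))`, induced by a graded homomorphism
`F : A → Mₙ(C)`. -/
def cyclicTrace (i : ZMod 2) : SuperCyclic 𝒜 i →ₗ[ℂ] 𝒞 i :=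
  Submodule.liftQ _
    (LinearMap.codRestrict (𝒞 i)
      (Matrix.traceLinearMap (Fin n) ℂ C ∘ₗ F.toLinearMap ∘ₗ (𝒜 i).subtype)
      fun a => by
        change (∑ h, F a h h) ∈ 𝒞 i
        exact Submodule.sum_mem _ fun h _ => hF a.2 h h)
    (by
      rintro ⟨a, ha⟩ h
      have key : superCommutators 𝒜 ≤
          LinearMap.ker (Matrix.traceLinearMap (Fin n) ℂ C ∘ₗ F.toLinearMap) := by
        refine Submodule.span_le.2 ?_
        rintro _ ⟨i, j, a, ha, b, hb, rfl⟩
        have e := hC.trace_mul (hF ha) (hF hb)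
        have e2 : ((-1 : ℤˣ) ^ (i * j) • (F b * F a)).trace =
            (-1 : ℤˣ) ^ (i * j) • (F b * F a).trace := Matrix.trace_smul _ _
        have e3 : F ((-1 : ℤˣ) ^ (i * j) • (b * a)) = (-1 : ℤˣ) ^ (i * j) • (F b * F a) := by
          rw [Units.smul_def, Units.smul_def, map_zsmul, map_mul]
        change (F (a * b - (-1 : ℤˣ) ^ (i * j) • (b * a))).trace = 0
        rw [map_sub, e3, map_mul, Matrix.trace_sub, e2, e, sub_self]
      exact Subtype.ext (key h))

/-- The homomorphism of trace algebras `𝕂(A / [A, A]ₛ) → C` with `t(a) ↦ tr(F(a))`. -/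
def evalTraceAlg : TraceAlg 𝒜 →ₐ[ℂ] C :=
  SuperSym.lift hC (cyclicTrace hC F hF 0) (cyclicTrace hC F hF 1)

theorem evalTraceAlg_anticomm ⦃i j : ZMod 2⦄ (a : 𝒜 i)
    (b : SuperSym.grading (SuperCyclic 𝒜 0) (SuperCyclic 𝒜 1) j) :
    F a * ((Matrix.scalarAlgHom (Fin n) ℂ).comp (evalTraceAlg hC F hF)) b =
      (-1 : ℤˣ) ^ (j * i) •
        (((Matrix.scalarAlgHom (Fin n) ℂ).comp (evalTraceAlg hC F hF)) b * F a) := by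
  ext h k
  have hb : evalTraceAlg hC F hF b ∈ 𝒞 j := SuperSym.lift_mem hC _ _ b.2
  simpa [mul_comm j i] using hC (hF a.2 h k) hb

variable [GradedAlgebra 𝒜]

/-- The trace preserving homomorphism `A_t → Mₙ(C)` extending a graded homomorphism
`F : A → Mₙ(C)`; the trace algebra is mapped to `C`, embedded as scalar matrices. -/
def evalWithTrace : WithTrace 𝒜 →ₐ[ℂ] Matrix (Fin n) (Fin n) C :=
  GradedTensorProduct.lift 𝒜 (SuperSym.grading (SuperCyclic 𝒜 0) (SuperCyclic 𝒜 1)) F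
    ((Matrix.scalarAlgHom (Fin n) ℂ).comp (evalTraceAlg hC F hF)) (evalTraceAlg_anticomm hC F hF)

theorem evalWithTrace_of (a : A) : evalWithTrace hC F hF (WithTrace.of 𝒜 a) = F a :=
  (GradedTensorProduct.lift_tmul 𝒜 _ F _ (evalTraceAlg_anticomm hC F hF) a 1).trans (by simp)

theorem evalWithTrace_ofTraceAlg (c : TraceAlg 𝒜) :
    evalWithTrace hC F hF (WithTrace.ofTraceAlg 𝒜 c) =
      Matrix.scalar (Fin n) (evalTraceAlg hC F hF c) :=
  (GradedTensorProduct.lift_tmul 𝒜 _ F _ (evalTraceAlg_anticomm hC F hF) 1 c).trans (by simp)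

theorem evalTraceAlg_formalTrace (a : A) :
    evalTraceAlg hC F hF (formalTrace 𝒜 a) = (F a).trace := by
  induction a using DirectSum.Decomposition.inductionOn 𝒜 with
  | zero => simp
  | @homogeneous i a =>
    have h0 := SuperSym.lift_ιEven hC (cyclicTrace hC F hF 0) (cyclicTrace hC F hF 1)
    have h1 := SuperSym.lift_ιOdd hC (cyclicTrace hC F hF 0) (cyclicTrace hC F hF 1)
    simp only [formalTrace, LinearMap.add_apply, LinearMap.comp_apply, map_add, evalTraceAlg, h0, h1]
    fin_cases i
    · have e0 : (DirectSum.component ℂ (ZMod 2) (fun i => 𝒜 i) 0)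
          (DirectSum.decomposeLinearEquiv 𝒜 (a : A)) = a := by
        change DirectSum.decompose 𝒜 (a : A) 0 = a
        exact Subtype.ext (DirectSum.decompose_of_mem_same 𝒜 a.2)
      have e1 : (DirectSum.component ℂ (ZMod 2) (fun i => 𝒜 i) 1)
          (DirectSum.decomposeLinearEquiv 𝒜 (a : A)) = 0 := by
        change DirectSum.decompose 𝒜 (a : A) 1 = 0
        exact Subtype.ext (DirectSum.decompose_of_mem_ne 𝒜 a.2 zero_ne_one)
      erw [e0, e1]
      simp
      rfl
    · have e0 : (DirectSum.component ℂ (ZMod 2) (fun i => 𝒜 i) 1)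
          (DirectSum.decomposeLinearEquiv 𝒜 (a : A)) = a := by
        change DirectSum.decompose 𝒜 (a : A) 1 = a
        exact Subtype.ext (DirectSum.decompose_of_mem_same 𝒜 a.2)
      have e1 : (DirectSum.component ℂ (ZMod 2) (fun i => 𝒜 i) 0)
          (DirectSum.decomposeLinearEquiv 𝒜 (a : A)) = 0 := by
        change DirectSum.decompose 𝒜 (a : A) 0 = 0
        exact Subtype.ext (DirectSum.decompose_of_mem_ne 𝒜 a.2 one_ne_zero)
      erw [e0, e1]
      simp
      rfl
  | add a b ha hb => simp only [map_add, Matrix.trace_add, ha, hb]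

theorem evalTraceAlg_trace (x : WithTrace 𝒜) :
    evalTraceAlg hC F hF (WithTrace.trace 𝒜 x) = (evalWithTrace hC F hF x).trace := by
  change TensorProduct ℂ A (TraceAlg 𝒜) at x
  induction x using TensorProduct.induction_on with
  | zero => erw [map_zero, map_zero]; exact (Matrix.trace_zero (Fin n) C).symm
  | add x y hx hy =>
    refine ((congrArg _ (map_add _ _ _)).trans (map_add _ _ _)).trans ?_
    rw [hx, hy, ← Matrix.trace_add]
    exact congrArg _ (map_add _ _ _).symm
  | tmul a c =>
    change evalTraceAlg hC F hF (formalTrace 𝒜 a * c) =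
      (F a * Matrix.scalar (Fin n) (evalTraceAlg hC F hF c)).trace
    rw [map_mul, evalTraceAlg_formalTrace]
    simp [Matrix.trace, Finset.sum_mul]

end Evaluation

/-! ### The free superalgebra with trace -/

section Free

variable (e f : ℕ)

/-- The free algebra `ℂ⟨X, Y⟩`, with basis the words in the bosonic variables `y₁, …, yₑ`
(`Sum.inl i`) and the fermionic variables `x₁, …, x_f` (`Sum.inr j`). -/
abbrev FreeSuperAlg : Type := AddMonoidAlgebra ℂ (FreeAddMonoid (Fin e ⊕ Fin f))

/-- The parity of a word: the number of its fermionic letters modulo 2. -/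
def wordParity : FreeAddMonoid (Fin e ⊕ Fin f) →+ ZMod 2 :=
  FreeAddMonoid.lift (Sum.elim (fun _ => 0) fun _ => 1)

/-- The parity grading of the free algebra. -/
abbrev freeGrading : ZMod 2 → Submodule ℂ (FreeSuperAlg e f) :=
  AddMonoidAlgebra.gradeBy ℂ (wordParity e f)

/-- The trace algebra `𝒯` of the free superalgebra with trace. -/
abbrev FreeTraceAlg : Type := TraceAlg (freeGrading e f)

/-- The free superalgebra with trace `ℱ_T⟨X, Y⟩ = ℂ⟨X, Y⟩ ⊗̂ 𝒯`. -/
abbrev FreeSuperTrace : Type := WithTrace (freeGrading e f)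

end Free

/-! ### Generic bosonic and fermionic matrices -/

section Generic

variable (n e f : ℕ)

/-- The space of `m`-tuples of complex `n × n` matrices. -/
abbrev MatTuple (m : ℕ) : Type := Fin m → Matrix (Fin n) (Fin n) ℂ

/-- The algebra `S = 𝕂(V*) = S(V₀*) ⊗ ⋀ V₁*`, where `V₀` is the space of `e`-tuples and `V₁` the
space of `f`-tuples of matrices. -/
abbrev InvAmbient : Type :=
  SuperSym (Module.Dual ℂ (MatTuple n e)) (Module.Dual ℂ (MatTuple n f))

/-- The parity grading of `S`. -/
abbrev ambientGrading : ZMod 2 → Submodule ℂ (InvAmbient n e f) :=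
  SuperSym.grading (Module.Dual ℂ (MatTuple n e)) (Module.Dual ℂ (MatTuple n f))

variable {n}

/-- The coordinate function `(A₁, …, A_m) ↦ (Aᵢ)ₕₖ`. -/
def coordFun {m : ℕ} (i : Fin m) (h k : Fin n) : Module.Dual ℂ (MatTuple n m) :=
  Matrix.entryLinearMap ℂ ℂ h k ∘ₗ LinearMap.proj i

variable (n)

/-- The generic matrices: `ηᵢ`, with the even entries `ηₕₖ⁽ⁱ⁾`, and `ξⱼ`, with the odd entries
`ξₕₖ⁽ʲ⁾`. -/
def genericMatrix : Fin e ⊕ Fin f → Matrix (Fin n) (Fin n) (InvAmbient n e f)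
  | Sum.inl i => Matrix.of fun h k => SuperSym.ιEven _ _ (coordFun i h k)
  | Sum.inr j => Matrix.of fun h k => SuperSym.ιOdd _ _ (coordFun j h k)

/-- The monomial in the generic matrices given by a word. -/
def genericMonomial (w : List (Fin e ⊕ Fin f)) : Matrix (Fin n) (Fin n) (InvAmbient n e f) :=
  (w.map (genericMatrix n e f)).prod

/-- The evaluation `ℂ⟨X, Y⟩ → Mₙ(S)`, `yᵢ ↦ ηᵢ`, `xⱼ ↦ ξⱼ`. -/
def evalFree : FreeSuperAlg e f →ₐ[ℂ] Matrix (Fin n) (Fin n) (InvAmbient n e f) :=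
  AddMonoidAlgebra.lift ℂ _ _
    { toFun := fun w => genericMonomial n e f w.toAdd.toList
      map_one' := by simp [genericMonomial]
      map_mul' := fun v w => by simp [genericMonomial] }

theorem genericMonomial_mem (w : List (Fin e ⊕ Fin f)) (h k : Fin n) :
    genericMonomial n e f w h k ∈
      ambientGrading n e f (wordParity e f (FreeAddMonoid.ofList w)) := by
  induction w generalizing h k with
  | nil =>
    by_cases hk : h = k
    · subst hk
      simpa [genericMonomial] using SetLike.GradedOne.one_mem (A := ambientGrading n e f)
    · simp [genericMonomial, Matrix.one_apply_ne hk]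
  | cons x w ih =>
    have hx : ∀ l, genericMatrix n e f x h l ∈
        ambientGrading n e f (wordParity e f (FreeAddMonoid.of x)) := by
      intro l
      cases x with
      | inl i => simpa [wordParity, genericMatrix] using SuperSym.ιEven_mem (coordFun i h l)
      | inr j => simpa [wordParity, genericMatrix] using SuperSym.ιOdd_mem (coordFun j h l)
    have hw : genericMonomial n e f (x :: w) = genericMatrix n e f x * genericMonomial n e f w := by
      simp [genericMonomial]
    rw [hw, Matrix.mul_apply, FreeAddMonoid.ofList_cons, map_add]
    exact Submodule.sum_mem _ fun l _ => SetLike.mul_mem_graded (hx l) (ih l k)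

theorem evalFree_mem ⦃i : ZMod 2⦄ ⦃a : FreeSuperAlg e f⦄ (ha : a ∈ freeGrading e f i)
    (h k : Fin n) : evalFree n e f a h k ∈ ambientGrading n e f i := by
  rw [evalFree, AddMonoidAlgebra.lift_apply, Finsupp.sum, Matrix.sum_apply]
  refine Submodule.sum_mem _ fun w hw => ?_
  rw [Matrix.smul_apply]
  have := genericMonomial_mem n e f w.toList h k
  rw [FreeAddMonoid.ofList_toList, ha w hw] at this
  exact Submodule.smul_mem _ _ this

/-- The evaluation of the free superalgebra with trace in `Mₙ(S)`: the trace preserving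
homomorphism with `yᵢ ↦ ηᵢ` and `xⱼ ↦ ξⱼ`. -/
def evalGeneric : FreeSuperTrace e f →ₐ[ℂ] Matrix (Fin n) (Fin n) (InvAmbient n e f) :=
  evalWithTrace (SuperSym.isSuperComm _ _) (evalFree n e f) (evalFree_mem n e f)

/-- The restriction `𝒯 → S` of the evaluation to the trace algebras. -/
def evalGenericTrace : FreeTraceAlg e f →ₐ[ℂ] InvAmbient n e f :=
  evalTraceAlg (SuperSym.isSuperComm _ _) (evalFree n e f) (evalFree_mem n e f)

end Generic

/-! ### The action of the general linear group -/

section Action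

variable {n : ℕ} (e f : ℕ)

/-- Simultaneous conjugation `(A₁, …, A_m) ↦ (g A₁ g⁻¹, …, g A_m g⁻¹)`. -/
def conjTuple (m : ℕ) (g : GL (Fin n) ℂ) : MatTuple n m →ₗ[ℂ] MatTuple n m where
  toFun A := fun i => (g : Matrix (Fin n) (Fin n) ℂ) * A i * (g⁻¹ : GL (Fin n) ℂ)
  map_add' A B := by funext i; simp [mul_add, add_mul]
  map_smul' c A := by funext i; simp

/-- The contragredient action on linear functions, `(g φ)(A) = φ(g⁻¹ A)`. -/
def dualAct (m : ℕ) (g : GL (Fin n) ℂ) :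
    Module.Dual ℂ (MatTuple n m) →ₗ[ℂ] Module.Dual ℂ (MatTuple n m) :=
  Module.Dual.transpose (R := ℂ) (conjTuple m g⁻¹)

/-- The action of `g` on `S = S(V₀*) ⊗ ⋀ V₁*` by algebra automorphisms extending the action
on `V*`. -/
def actS (g : GL (Fin n) ℂ) : InvAmbient n e f →ₐ[ℂ] InvAmbient n e f :=
  Algebra.TensorProduct.map
    (SymmetricAlgebra.lift (SymmetricAlgebra.ι ℂ (Module.Dual ℂ (MatTuple n e)) ∘ₗ dualAct e g))
    (ExteriorAlgebra.map (dualAct f g))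

/-- A complex matrix as a matrix over `S`. -/
abbrev constMat : Matrix (Fin n) (Fin n) ℂ →ₐ[ℂ] Matrix (Fin n) (Fin n) (InvAmbient n e f) :=
  (Algebra.ofId ℂ (InvAmbient n e f)).mapMatrix

theorem constMat_inv_mul (g : GL (Fin n) ℂ) :
    constMat e f ((g⁻¹ : GL (Fin n) ℂ) : Matrix (Fin n) (Fin n) ℂ) * constMat e f g = 1 := by
  rw [← map_mul, ← Units.val_mul, inv_mul_cancel, Units.val_one, map_one]

theorem constMat_mul_inv (g : GL (Fin n) ℂ) :
    constMat e f g * constMat e f ((g⁻¹ : GL (Fin n) ℂ) : Matrix (Fin n) (Fin n) ℂ) = 1 := by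
  rw [← map_mul, ← Units.val_mul, mul_inv_cancel, Units.val_one, map_one]

/-- The diagonal action of `g` on `Mₙ(S) = Mₙ(ℂ) ⊗ S`: conjugation by `g` on `Mₙ(ℂ)` and
the action `actS` on the entries. -/
def actMat (g : GL (Fin n) ℂ) :
    Matrix (Fin n) (Fin n) (InvAmbient n e f) →ₐ[ℂ] Matrix (Fin n) (Fin n) (InvAmbient n e f) where
  toFun M := constMat e f g * (actS e f g).mapMatrix M *
    constMat e f ((g⁻¹ : GL (Fin n) ℂ) : Matrix (Fin n) (Fin n) ℂ)
  map_one' := by rw [map_one, mul_one, constMat_mul_inv]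
  map_mul' M N := by
    have hg := constMat_inv_mul e f g
    rw [map_mul]
    simp only [mul_assoc]
    rw [← mul_assoc (constMat e f _) (constMat e f _), hg, one_mul]
  map_zero' := by rw [map_zero, mul_zero, zero_mul]
  map_add' M N := by rw [map_add, mul_add, add_mul]
  commutes' r := by
    rw [AlgHom.commutes, ← Algebra.commutes, mul_assoc, constMat_mul_inv, mul_one]

variable (n)

/-- The algebra `𝒯ₙ = S^G` of invariants, `G = GL(n, ℂ)`. -/
def invariants : Subalgebra ℂ (InvAmbient n e f) where
  carrier := {s | ∀ g : GL (Fin n) ℂ, actS e f g s = s}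
  mul_mem' ha hb g := by rw [map_mul, ha g, hb g]
  add_mem' ha hb g := by rw [map_add, ha g, hb g]
  algebraMap_mem' r g := AlgHom.commutes _ r

/-- The algebra `ℰₙ = Mₙ(S)^G` of equivariant maps, `G = GL(n, ℂ)`. -/
def equivariants : Subalgebra ℂ (Matrix (Fin n) (Fin n) (InvAmbient n e f)) where
  carrier := {M | ∀ g : GL (Fin n) ℂ, actMat e f g M = M}
  mul_mem' ha hb g := by rw [map_mul, ha g, hb g]
  add_mem' ha hb g := by rw [map_add, ha g, hb g]
  algebraMap_mem' r g := AlgHom.commutes _ r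

end Action

end

/-! The easy inclusion holds because `g` acts on the entries of a generic matrix by conjugation with
`g⁻¹`. The diagonal action therefore fixes every monomial, and `G` fixes its trace.

For the converse, write the entries of an equivariant matrix as combinations of products of exactly
`d` entries of generic matrices or of the identity, and let one further slot record the position in
the matrix. This presents the matrix as the image of a coefficient vector in a direct sum of copies
of the `(d+1)`-st tensor power of `Mₙ(ℂ)`, under a `G`-equivariant linear map. The operators of `G`
on coefficients are closed under adjoints, so the orthogonal complement of the kernel is stable and
the coefficient vector can be chosen fixed (`exists_fixed_lift`). A fixed vector is a family of
matrices commuting with all `g ⊗ ⋯ ⊗ g`, and Schur–Weyl duality (`mem_span_placePerm`) makes it a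
combination of permutations.

The image of a permutation is a contraction of products of matrix entries (`exists_contraction_eq`).
Each cycle avoiding the position slot closes up to the trace of a monomial, and the cycle through it
gives a monomial matrix. Supercommutativity enters only through reordering factors. The resulting
sign depends on parities alone, hence is the same for all matrix indices, and disappears in linear
spans.

The statement on invariants follows by taking the trace of the equivariant matrix `s · 1`, with `n =
0` treated apart. The images of the evaluation maps are then found on generators. -/

noncomputable section

/-! ### Schur–Weyl duality for tensor powers of matrices -/

section SchurWeyl

variable {n d : ℕ}

/-- The `d`-th tensor power of a matrix. -/
def tensorPowMatrix (d : ℕ) (A : Matrix (Fin n) (Fin n) ℂ) :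
    Matrix (Fin d → Fin n) (Fin d → Fin n) ℂ :=
  Matrix.of fun i j => ∏ a, A (i a) (j a)

theorem tensorPowMatrix_apply (A : Matrix (Fin n) (Fin n) ℂ) (i j : Fin d → Fin n) :
    tensorPowMatrix d A i j = ∏ a, A (i a) (j a) := rfl

theorem tensorPowMatrix_mul (A B : Matrix (Fin n) (Fin n) ℂ) :
    tensorPowMatrix d (A * B) = tensorPowMatrix d A * tensorPowMatrix d B := by
  ext i j
  simp only [tensorPowMatrix_apply, Matrix.mul_apply, Finset.prod_univ_sum, Fintype.piFinset_univ,
    Finset.prod_mul_distrib]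

theorem tensorPowMatrix_one : tensorPowMatrix d (1 : Matrix (Fin n) (Fin n) ℂ) = 1 := by
  ext i j
  simp only [tensorPowMatrix_apply, Matrix.one_apply]
  by_cases h : i = j
  · simp [h]
  · obtain ⟨a, ha⟩ := Function.ne_iff.1 h
    rw [if_neg h]
    exact Finset.prod_eq_zero (Finset.mem_univ a) (if_neg ha)

/-- The permutation of the tensor factors given by `σ`. -/
def placePerm (n : ℕ) {d : ℕ} (σ : Equiv.Perm (Fin d)) :
    Matrix (Fin d → Fin n) (Fin d → Fin n) ℂ :=
  Matrix.of fun i j => if i = j ∘ σ then 1 else 0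

theorem placePerm_apply (σ : Equiv.Perm (Fin d)) (i j : Fin d → Fin n) :
    placePerm n σ i j = if i = j ∘ σ then 1 else 0 := rfl

theorem placePerm_mul_apply {κ : Type*} (σ : Equiv.Perm (Fin d))
    (B : Matrix (Fin d → Fin n) κ ℂ) (i : Fin d → Fin n) (k : κ) :
    (placePerm n σ * B) i k = B (i ∘ σ.symm) k := by
  rw [Matrix.mul_apply, Finset.sum_eq_single (i ∘ σ.symm)]
  · rw [placePerm_apply, if_pos, one_mul]
    ext a
    simp
  · intro j _ hj
    rw [placePerm_apply, if_neg, zero_mul]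
    rintro rfl
    exact hj (by ext a; simp)
  · simp

theorem placePerm_one : placePerm n (1 : Equiv.Perm (Fin d)) = 1 := by
  ext i j
  simp [placePerm_apply, Matrix.one_apply]

/-- The order is reversed because permutations act by precomposition on index functions. -/
theorem placePerm_mul (σ τ : Equiv.Perm (Fin d)) :
    placePerm n σ * placePerm n τ = placePerm n (τ * σ) := by
  ext i j
  rw [placePerm_mul_apply, placePerm_apply, placePerm_apply]
  congr 1
  refine propext ⟨fun h => ?_, fun h => ?_⟩
  · ext a
    simpa using congrArg Fin.val (congrFun h (σ a))
  · subst h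
    ext a
    simp

/-- A linear functional on tensors that vanishes on the tensor powers of invertible matrices
vanishes on all symmetric tensors. -/
theorem sum_mul_eq_zero_of_forall_GL (l B : (Fin d → Fin n × Fin n) → ℂ)
    (hl : ∀ g : GL (Fin n) ℂ,
      ∑ J, l J * ∏ a, (g : Matrix (Fin n) (Fin n) ℂ) (J a).1 (J a).2 = 0)
    (hB : ∀ (σ : Equiv.Perm (Fin d)) J, B (J ∘ σ) = B J) :
    ∑ J, B J * l J = 0 := by
  classical
  let P : MvPolynomial (Fin n × Fin n) ℂ :=
    ∑ J : Fin d → Fin n × Fin n, MvPolynomial.C (l J) * ∏ a, MvPolynomial.X (J a)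
  -- Zariski density of `GL`: the product vanishes at invertible matrices by hypothesis and at
  -- singular ones because of the determinant, which is a nonzero polynomial.
  have hP : P * (Matrix.mvPolynomialX (Fin n) (Fin n) ℂ).det = 0 := by
    refine MvPolynomial.funext fun x => ?_
    have hdet : MvPolynomial.eval x (Matrix.mvPolynomialX (Fin n) (Fin n) ℂ).det =
        (Matrix.of fun i j => x (i, j)).det := by
      rw [RingHom.map_det]
      congr 1
      ext i j
      simp [Matrix.mvPolynomialX]
    rw [map_mul, hdet, map_zero]
    by_cases h : (Matrix.of fun i j => x (i, j)).det = 0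
    · rw [h, mul_zero]
    · have := hl (Matrix.GeneralLinearGroup.mkOfDetNeZero _ h)
      simp only [Matrix.GeneralLinearGroup.val_mkOfDetNeZero, Matrix.of_apply] at this
      simp only [P, map_sum, map_mul, MvPolynomial.eval_C, map_prod, MvPolynomial.eval_X]
      rw [this, zero_mul]
  have hP0 : P = 0 :=
    (mul_eq_zero.1 hP).resolve_right (Matrix.det_mvPolynomialX_ne_zero (Fin n) ℂ)
  -- `ty J` is the exponent of the monomial attached to `J`. Indices with equal exponents differ by
  -- a permutation matching their fibres, so the symmetric `B` descends to exponents and defines a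
  -- functional `Λ` on polynomials. The claim is `Λ P = 0`.
  let ty : (Fin d → Fin n × Fin n) → (Fin n × Fin n →₀ ℕ) := fun J => ∑ a, Finsupp.single (J a) 1
  have hty : ∀ J J', ty J = ty J' → B J = B J' := by
    intro J J' h
    have hcard : ∀ x, Fintype.card {a // J a = x} = Fintype.card {a // J' a = x} := by
      intro x
      have := DFunLike.congr_fun h x
      simpa [ty, Finsupp.single_apply, Fintype.card_subtype] using this
    let σ : Equiv.Perm (Fin d) := (Equiv.sigmaFiberEquiv J).symm.trans
      ((Equiv.sigmaCongrRight fun x => Fintype.equivOfCardEq (hcard x)).trans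
        (Equiv.sigmaFiberEquiv J'))
    have hσ : J = J' ∘ σ := funext fun a =>
      (Fintype.equivOfCardEq (hcard (J a)) ⟨a, rfl⟩).2.symm
    rw [hσ, hB]
  let B' : (Fin n × Fin n →₀ ℕ) → ℂ := Function.extend ty B 0
  have hB' : ∀ J, B' (ty J) = B J := fun J => Function.FactorsThrough.extend_apply hty 0 J
  have hPm : P = ∑ J, MvPolynomial.monomial (ty J) (l J) := by
    refine Finset.sum_congr rfl fun J _ => ?_
    rw [MvPolynomial.monomial_sum_index]
    rfl
  let Λ : MvPolynomial (Fin n × Fin n) ℂ →ₗ[ℂ] ℂ :=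
    (MvPolynomial.basisMonomials (Fin n × Fin n) ℂ).constr ℂ B'
  have hΛ : ∀ m r, Λ (MvPolynomial.monomial m r) = r * B' m := by
    intro m r
    have : MvPolynomial.monomial m r = r • MvPolynomial.basisMonomials (Fin n × Fin n) ℂ m := by
      simp [MvPolynomial.smul_monomial]
    rw [this, map_smul, Module.Basis.constr_basis, smul_eq_mul]
  have := congrArg Λ hPm
  rw [hP0, map_zero, map_sum] at this
  rw [this]
  exact Finset.sum_congr rfl fun J _ => by rw [hΛ, hB', mul_comm]

/-- Each entry of the commutator of `T` with a variable matrix is a linear functional of that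
matrix. It vanishes on tensor powers of invertible matrices, hence on the symmetric tensor `B`. -/
theorem commute_of_forall_commute_tensorPowMatrix
    {T B : Matrix (Fin d → Fin n) (Fin d → Fin n) ℂ}
    (hT : ∀ g : GL (Fin n) ℂ, Commute T (tensorPowMatrix d g))
    (hB : ∀ (σ : Equiv.Perm (Fin d)) i j, B (i ∘ σ) (j ∘ σ) = B i j) : Commute T B := by
  ext i k
  let E : ((Fin d → Fin n × Fin n)) ≃ (Fin d → Fin n) × (Fin d → Fin n) :=
    Equiv.arrowProdEquivProdArrow _ _ _
  let l : (Fin d → Fin n) × (Fin d → Fin n) → ℂ := fun q =>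
    (if q.2 = k then T i q.1 else 0) - (if q.1 = i then T q.2 k else 0)
  have key : ∀ A : Matrix (Fin d → Fin n) (Fin d → Fin n) ℂ,
      (T * A) i k - (A * T) i k = ∑ J, A (E J).1 (E J).2 * l (E J) := by
    intro A
    rw [E.sum_comp (fun q => A q.1 q.2 * l q), Fintype.sum_prod_type]
    simp only [l, mul_sub, Finset.sum_sub_distrib, Matrix.mul_apply, mul_ite, mul_zero]
    congr 1
    · refine Finset.sum_congr rfl fun j _ => ?_
      simp [mul_comm]
    · rw [Finset.sum_comm]
      simp
  rw [← sub_eq_zero, key]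
  refine sum_mul_eq_zero_of_forall_GL (fun J => l (E J)) _ (fun g => ?_) fun σ J => ?_
  swap
  · exact hB σ (E J).1 (E J).2
  have := key (tensorPowMatrix d g)
  rw [(hT g).eq, sub_self] at this
  rw [this]
  exact Finset.sum_congr rfl fun J _ => mul_comm _ _

/-- Schur–Weyl duality: a matrix commuting with all `g ⊗ ⋯ ⊗ g` is a linear combination of
permutations of the tensor factors. -/
theorem mem_span_placePerm {T : Matrix (Fin d → Fin n) (Fin d → Fin n) ℂ}
    (hT : ∀ g : GL (Fin n) ℂ, Commute T (tensorPowMatrix d g)) :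
    T ∈ Submodule.span ℂ (Set.range fun σ : Equiv.Perm (Fin d) => placePerm n σ) := by
  set 𝓟 := Submodule.span ℂ (Set.range fun σ : Equiv.Perm (Fin d) => placePerm n σ) with h𝓟
  have hmem : ∀ σ, placePerm n σ ∈ 𝓟 := fun σ => Submodule.subset_span ⟨σ, rfl⟩
  have hmul : ∀ σ : Equiv.Perm (Fin d), ∀ X ∈ 𝓟, placePerm n σ * X ∈ 𝓟 := by
    intro σ X hX
    induction hX using Submodule.span_induction with
    | zero => simp
    | add X Y _ _ hX hY => rw [mul_add]; exact add_mem hX hY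
    | smul c X _ hX => rw [Matrix.mul_smul]; exact Submodule.smul_mem _ _ hX
    | mem X hX =>
      obtain ⟨τ, rfl⟩ := hX
      simp only [placePerm_mul]
      exact hmem _
  -- Maschke's argument: `p` is any linear projection onto `𝓟`, and its average `q` is a projection
  -- commuting with left multiplication by permutations.
  obtain ⟨p, hp⟩ := LinearMap.exists_leftInverse_of_injective 𝓟.subtype (Submodule.ker_subtype _)
  have hp' : ∀ X (hX : X ∈ 𝓟), (p X : Matrix _ _ ℂ) = X := fun X hX =>
    congrArg Subtype.val (LinearMap.congr_fun hp ⟨X, hX⟩)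
  let q : Matrix (Fin d → Fin n) (Fin d → Fin n) ℂ →ₗ[ℂ]
      Matrix (Fin d → Fin n) (Fin d → Fin n) ℂ :=
    (d.factorial : ℂ)⁻¹ • ∑ σ : Equiv.Perm (Fin d),
      LinearMap.mulLeft ℂ (placePerm n σ⁻¹) ∘ₗ 𝓟.subtype ∘ₗ p ∘ₗ
        LinearMap.mulLeft ℂ (placePerm n σ)
  have hq : ∀ X, q X = (d.factorial : ℂ)⁻¹ • ∑ σ : Equiv.Perm (Fin d),
      placePerm n σ⁻¹ * (p (placePerm n σ * X) : Matrix _ _ ℂ) := by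
    intro X
    simp [q]
  have hq_mem : ∀ X, q X ∈ 𝓟 := by
    intro X
    rw [hq]
    exact Submodule.smul_mem _ _ (Submodule.sum_mem _ fun σ _ => hmul _ _ (p _).2)
  have hq_one : q 1 = 1 := by
    have hd : (d.factorial : ℂ) ≠ 0 := Nat.cast_ne_zero.2 d.factorial_ne_zero
    simp only [hq, mul_one, hp' _ (hmem _), placePerm_mul, mul_inv_cancel, placePerm_one,
      Finset.sum_const, Finset.card_univ, Fintype.card_perm, Fintype.card_fin]
    rw [← Nat.cast_smul_eq_nsmul ℂ, smul_smul, inv_mul_cancel₀ hd, one_smul]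
  have hq_comm : ∀ τ X, q (placePerm n τ * X) = placePerm n τ * q X := by
    intro τ X
    simp only [hq, Matrix.mul_smul, Matrix.mul_sum]
    congr 1
    rw [← Equiv.sum_comp (Equiv.mulLeft τ⁻¹)]
    refine Finset.sum_congr rfl fun σ _ => ?_
    simp [← mul_assoc, placePerm_mul]
  -- The matrix algebra is a sum of copies of the tensor space, one for each column, and `b k l` is
  -- the block of `q` from column `l` to column `k`. Equivariance of `q` makes every block
  -- symmetric, so `T` commutes with it.
  let b : (Fin d → Fin n) → (Fin d → Fin n) → Matrix (Fin d → Fin n) (Fin d → Fin n) ℂ :=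
    fun k l => Matrix.of fun i j => q (Matrix.single j l 1) i k
  have hqb : ∀ X i k, q X i k = ∑ l, (b k l * X) i l := by
    intro X i k
    conv_lhs => rw [Matrix.matrix_eq_sum_single X]
    simp only [map_sum, Matrix.sum_apply, Matrix.mul_apply]
    rw [Finset.sum_comm]
    refine Finset.sum_congr rfl fun l _ => Finset.sum_congr rfl fun j _ => ?_
    have : Matrix.single j l (X j l) = X j l • Matrix.single j l (1 : ℂ) := by simp
    rw [this, map_smul, Matrix.smul_apply, smul_eq_mul, mul_comm]
    rfl
  have hb : ∀ k l, Commute T (b k l) := by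
    intro k l
    refine commute_of_forall_commute_tensorPowMatrix hT fun σ i j => ?_
    have h1 : Matrix.single (j ∘ σ) l (1 : ℂ) = placePerm n σ * Matrix.single j l 1 := by
      ext i k
      rw [placePerm_mul_apply, Matrix.single_apply, Matrix.single_apply]
      congr 2
      refine propext ⟨fun h => ?_, fun h => ?_⟩
      · subst h
        ext a
        simp
      · rw [h]
        ext a
        simp
    change q (Matrix.single (j ∘ σ) l 1) (i ∘ σ) k = q (Matrix.single j l 1) i k
    rw [h1, hq_comm, placePerm_mul_apply]
    have h2 : (i ∘ σ) ∘ σ.symm = i := by ext a; simp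
    rw [h2]
  -- Commuting with all blocks means that `q` commutes with left multiplication by `T`, so `q T = T
  -- * q 1 = T`. This puts `T` in the image `𝓟`.
  have hqT : q T = T := by
    have h2 : ∀ i k, q (T * 1) i k = (T * q 1) i k := by
      intro i k
      rw [hqb, Matrix.mul_apply]
      simp only [hqb, Finset.mul_sum]
      rw [Finset.sum_comm]
      refine Finset.sum_congr rfl fun l _ => ?_
      rw [← mul_assoc, ← (hb k l).eq, mul_assoc, Matrix.mul_apply]
    have := Matrix.ext h2
    rwa [hq_one, mul_one] at this
  exact hqT ▸ hq_mem T

end SchurWeyl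

/-! ### Complete reducibility through adjoints -/

/-- Lifting of fixed vectors along an equivariant map, for a family of operators closed under
adjoints. -/
theorem exists_fixed_lift {E N ι : Type*} [NormedAddCommGroup E] [InnerProductSpace ℂ E]
    [FiniteDimensional ℂ E] [AddCommGroup N] [Module ℂ N] (Φ : E →ₗ[ℂ] N) (ρ : ι → E →ₗ[ℂ] E)
    (Γ : ι → N →ₗ[ℂ] N) (hadj : ∀ g, ∃ g', ∀ x y, inner ℂ x (ρ g y) = inner ℂ (ρ g' x) y)
    (hΦ : ∀ g x, Φ (ρ g x) = Γ g (Φ x)) {x : E} (hx : ∀ g, Γ g (Φ x) = Φ x) :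
    ∃ y, Φ y = Φ x ∧ ∀ g, ρ g y = y := by
  obtain ⟨k, hk, y, hy, rfl⟩ := (LinearMap.ker Φ).exists_add_mem_mem_orthogonal x
  have hxy : Φ (k + y) = Φ y := by rw [map_add, LinearMap.mem_ker.1 hk, zero_add]
  refine ⟨y, hxy.symm, fun g => ?_⟩
  rw [hxy] at hx
  obtain ⟨g', hg'⟩ := hadj g
  -- The difference lies both in the kernel and in its orthogonal complement. The complement is
  -- stable because the adjoint operators preserve the kernel.
  have h1 : ρ g y - y ∈ LinearMap.ker Φ := by
    rw [LinearMap.mem_ker, map_sub, hΦ, hx, sub_self]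
  have h2 : ρ g y ∈ (LinearMap.ker Φ)ᗮ := by
    rw [Submodule.mem_orthogonal]
    intro u hu
    rw [hg']
    refine (Submodule.mem_orthogonal _ _).1 hy _ ?_
    rw [LinearMap.mem_ker, hΦ, LinearMap.mem_ker.1 hu, map_zero]
  exact sub_eq_zero.1 (inner_self_eq_zero.1
    ((Submodule.mem_orthogonal _ _).1 (sub_mem h2 hy) _ h1))

/-! ### Invariants in quotients of mixed tensors -/

section Tensors

variable {n d : ℕ} {ω : Type*} [DecidableEq ω]

/-- The matrix of the action of `g` on the coefficients of families of mixed tensors. -/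
def coeffAct (n d : ℕ) (ω : Type*) [DecidableEq ω] (g : GL (Fin n) ℂ) :
    Matrix (ω × (Fin d → Fin n) × (Fin d → Fin n)) (ω × (Fin d → Fin n) × (Fin d → Fin n)) ℂ :=
  Matrix.of fun p q => if p.1 = q.1 then
    tensorPowMatrix d ((g⁻¹ : GL (Fin n) ℂ) : Matrix (Fin n) (Fin n) ℂ) q.2.1 p.2.1 *
      tensorPowMatrix d (g : Matrix (Fin n) (Fin n) ℂ) p.2.2 q.2.2 else 0

/-- The conjugate transpose of an invertible matrix. -/
def glConjTranspose (g : GL (Fin n) ℂ) : GL (Fin n) ℂ where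
  val := (g : Matrix (Fin n) (Fin n) ℂ).conjTranspose
  inv := ((g⁻¹ : GL (Fin n) ℂ) : Matrix (Fin n) (Fin n) ℂ).conjTranspose
  val_inv := by rw [← Matrix.conjTranspose_mul, Units.inv_mul, Matrix.conjTranspose_one]
  inv_val := by rw [← Matrix.conjTranspose_mul, Units.mul_inv, Matrix.conjTranspose_one]

/-- This supplies the closure under adjoints needed in `exists_fixed_lift`, replacing an average
over the unitary group. -/
theorem coeffAct_conjTranspose (g : GL (Fin n) ℂ) :
    (coeffAct n d ω g).conjTranspose = coeffAct n d ω (glConjTranspose g) := by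
  ext ⟨w, a, b⟩ ⟨w', h, k⟩
  have h1 : ((glConjTranspose g)⁻¹ : GL (Fin n) ℂ).val =
      ((g⁻¹ : GL (Fin n) ℂ) : Matrix (Fin n) (Fin n) ℂ).conjTranspose := rfl
  have h2 : (glConjTranspose g).val = (g : Matrix (Fin n) (Fin n) ℂ).conjTranspose := rfl
  simp only [coeffAct, Matrix.conjTranspose_apply, Matrix.of_apply, h1, h2, tensorPowMatrix_apply,
    eq_comm (a := w)]
  split_ifs <;> simp

/-- The invariants in a quotient of a sum of tensor powers of `Mₙ(ℂ)` are spanned by the images of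
the permutations. -/
theorem mem_span_of_forall_GL_fixed [Fintype ω] {N : Type*} [AddCommGroup N]
    [Module ℂ N] (Γ : GL (Fin n) ℂ → N →ₗ[ℂ] N) (m : ω → (Fin d → Fin n) → (Fin d → Fin n) → N)
    (hm : ∀ g w h k, Γ g (m w h k) = ∑ a, ∑ b,
      (tensorPowMatrix d ((g⁻¹ : GL (Fin n) ℂ) : Matrix (Fin n) (Fin n) ℂ) h a *
        tensorPowMatrix d (g : Matrix (Fin n) (Fin n) ℂ) b k) • m w a b)
    {s : N} (hs : s ∈ Submodule.span ℂ (Set.range fun q : ω × (Fin d → Fin n) × (Fin d → Fin n) =>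
      m q.1 q.2.1 q.2.2)) (hΓ : ∀ g, Γ g s = s) :
    s ∈ Submodule.span ℂ (Set.range fun q : ω × Equiv.Perm (Fin d) =>
      ∑ k, m q.1 (k ∘ q.2) k) := by
  let Φ : EuclideanSpace ℂ (ω × (Fin d → Fin n) × (Fin d → Fin n)) →ₗ[ℂ] N :=
    Fintype.linearCombination ℂ (fun q : ω × (Fin d → Fin n) × (Fin d → Fin n) =>
      m q.1 q.2.1 q.2.2) ∘ₗ (WithLp.linearEquiv 2 ℂ _).toLinearMap
  have hΦ : ∀ c, Φ c = ∑ w, ∑ h, ∑ k, c (w, h, k) • m w h k := by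
    intro c
    simp [Φ, Fintype.linearCombination_apply, Fintype.sum_prod_type]
  let ρ := fun g => Matrix.toEuclideanLin (coeffAct n d ω g)
  have hρ : ∀ g c w a b, ρ g c (w, a, b) = ∑ h, ∑ k,
      tensorPowMatrix d ((g⁻¹ : GL (Fin n) ℂ) : Matrix (Fin n) (Fin n) ℂ) h a *
        tensorPowMatrix d (g : Matrix (Fin n) (Fin n) ℂ) b k * c (w, h, k) := by
    intro g c w a b
    simp [ρ, Matrix.toLpLin_apply, Matrix.mulVec, dotProduct, coeffAct, Fintype.sum_prod_type,
      ite_mul, Finset.sum_ite_irrel]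
  obtain ⟨c, rfl⟩ : ∃ c, Φ c = s := by
    rw [Submodule.mem_span_range_iff_exists_fun] at hs
    obtain ⟨c, hc⟩ := hs
    exact ⟨WithLp.toLp 2 c, hc⟩
  obtain ⟨y, hy, hfix⟩ := exists_fixed_lift Φ ρ Γ (fun g => ⟨glConjTranspose g, fun x y => by
      simp only [ρ]
      rw [← coeffAct_conjTranspose, Matrix.toEuclideanLin_conjTranspose_eq_adjoint,
        LinearMap.adjoint_inner_left]⟩)
    (fun g c => by
      simp only [hΦ, hρ, map_sum, map_smul, hm, Finset.smul_sum, Finset.sum_smul, smul_smul]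
      refine Finset.sum_congr rfl fun w _ => ?_
      calc _ = ∑ a, ∑ h, ∑ b, ∑ k, (tensorPowMatrix d
              ((g⁻¹ : GL (Fin n) ℂ) : Matrix (Fin n) (Fin n) ℂ) h a *
            tensorPowMatrix d (g : Matrix (Fin n) (Fin n) ℂ) b k * c (w, h, k)) • m w a b :=
            Finset.sum_congr rfl fun a _ => Finset.sum_comm
        _ = ∑ h, ∑ a, ∑ k, ∑ b, (tensorPowMatrix d
              ((g⁻¹ : GL (Fin n) ℂ) : Matrix (Fin n) (Fin n) ℂ) h a *
            tensorPowMatrix d (g : Matrix (Fin n) (Fin n) ℂ) b k * c (w, h, k)) • m w a b := by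
          rw [Finset.sum_comm]
          exact Finset.sum_congr rfl fun h _ => Finset.sum_congr rfl fun a _ => Finset.sum_comm
        _ = _ := by
          refine Finset.sum_congr rfl fun h _ => Finset.sum_comm.trans ?_
          refine Finset.sum_congr rfl fun k _ => Finset.sum_congr rfl fun a _ =>
            Finset.sum_congr rfl fun b _ => ?_
          rw [mul_comm (c.ofLp (w, h, k))]) hΓ
  rw [← hy, hΦ]
  refine Submodule.sum_mem _ fun w _ => ?_
  let T : Matrix (Fin d → Fin n) (Fin d → Fin n) ℂ := Matrix.of fun h k => y (w, h, k)
  have hT : T ∈ Submodule.span ℂ (Set.range fun σ : Equiv.Perm (Fin d) => placePerm n σ) := by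
    refine mem_span_placePerm fun g => ?_
    -- The action on coefficients sends `T` to the product of the transposed tensor powers of `g⁻¹`
    -- and `g` around `T`. Applying it to the transpose of `g` turns invariance into commutation
    -- with `g ⊗ ⋯ ⊗ g`.
    let g' : GL (Fin n) ℂ :=
      { val := (g : Matrix (Fin n) (Fin n) ℂ).transpose
        inv := ((g⁻¹ : GL (Fin n) ℂ) : Matrix (Fin n) (Fin n) ℂ).transpose
        val_inv := by rw [← Matrix.transpose_mul, Units.inv_mul, Matrix.transpose_one]
        inv_val := by rw [← Matrix.transpose_mul, Units.mul_inv, Matrix.transpose_one] }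
    have hTg : tensorPowMatrix d ((g⁻¹ : GL (Fin n) ℂ) : Matrix (Fin n) (Fin n) ℂ) * T *
        tensorPowMatrix d (g : Matrix (Fin n) (Fin n) ℂ) = T := by
      ext a b
      have h1 := congrArg (fun c => c.ofLp (w, a, b)) (hfix g')
      simp only [hρ] at h1
      refine Eq.trans ?_ h1
      simp only [Matrix.mul_apply, Finset.sum_mul]
      rw [Finset.sum_comm]
      refine Finset.sum_congr rfl fun h _ => Finset.sum_congr rfl fun k _ => ?_
      exact mul_right_comm _ _ _
    have hgg : tensorPowMatrix d (g : Matrix (Fin n) (Fin n) ℂ) *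
        tensorPowMatrix d ((g⁻¹ : GL (Fin n) ℂ) : Matrix (Fin n) (Fin n) ℂ) = 1 := by
      rw [← tensorPowMatrix_mul, Units.mul_inv, tensorPowMatrix_one]
    change T * _ = _ * T
    nth_rewrite 2 [← hTg]
    rw [← mul_assoc, ← mul_assoc, hgg, one_mul]
  obtain ⟨z, hz⟩ := (Submodule.mem_span_range_iff_exists_fun ℂ).1 hT
  have : ∑ h, ∑ k, y (w, h, k) • m w h k = ∑ σ, z σ • ∑ k, m w (k ∘ σ) k := by
    have : ∀ h k, y (w, h, k) = ∑ σ, z σ * (if h = k ∘ σ then 1 else 0) := by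
      intro h k
      have := congrFun (congrFun hz h) k
      simpa [Matrix.sum_apply, placePerm_apply, T] using this.symm
    simp only [this, Finset.sum_smul, Finset.smul_sum]
    rw [Finset.sum_comm]
    simp_rw [Finset.sum_comm (s := Finset.univ (α := Fin d → Fin n))
      (t := Finset.univ (α := Equiv.Perm (Fin d)))]
    simp
  rw [this]
  exact Submodule.sum_mem _ fun σ _ => Submodule.smul_mem _ _ (Submodule.subset_span ⟨(w, σ), rfl⟩)

end Tensors

/-! ### Reordering products in a supercommutative algebra -/

theorem List.prod_ofFn_update_sum {C ι : Type*} [Ring C] {d : ℕ}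
    (y : Fin d → C) (j : Fin d) (s : Finset ι) (v : ι → C) :
    (List.ofFn (Function.update y j (∑ a ∈ s, v a))).prod =
      ∑ a ∈ s, (List.ofFn (Function.update y j (v a))).prod := by
  simpa using (MultilinearMap.mkPiAlgebraFin ℤ d C).map_update_sum s j v y

theorem Matrix.trace_scalar_mul {n C : Type*} [Fintype n] [DecidableEq n] [Ring C] (t : C)
    (Q : Matrix n n C) : (Matrix.scalar n t * Q).trace = t * Q.trace := by
  simp [Matrix.trace, Finset.mul_sum]

namespace IsSuperComm

variable {C : Type*} [Ring C] [Algebra ℂ C] {𝒞 : ZMod 2 → Submodule ℂ C}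

/-- The value of the sign is irrelevant to spans. What matters is that `ε` is chosen before the
elements, so that it can be pulled out of sums over matrix indices. -/
theorem exists_scalar_mul_comm (hC : IsSuperComm 𝒞) (i j : ZMod 2) :
    ∃ ε : ℂ, ∀ a ∈ 𝒞 i, ∀ b ∈ 𝒞 j, a * b = ε • (b * a) := by
  refine ⟨(((-1 : ℤˣ) ^ (i * j) : ℤˣ) : ℤ), fun a ha b hb => ?_⟩
  rw [hC ha hb, Units.smul_def, Int.cast_smul_eq_zsmul]

theorem exists_scalar_mul_prod_comm [GradedAlgebra 𝒞] (hC : IsSuperComm 𝒞) {d : ℕ} (i : ZMod 2)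
    (p : Fin d → ZMod 2) : ∃ ε : ℂ, ∀ x ∈ 𝒞 i, ∀ y : Fin d → C, (∀ j, y j ∈ 𝒞 (p j)) →
      x * (List.ofFn y).prod = ε • ((List.ofFn y).prod * x) := by
  obtain ⟨ε, hε⟩ := hC.exists_scalar_mul_comm i (List.ofFn p).sum
  exact ⟨ε, fun x hx y hy => hε x hx _ (SetLike.list_prod_ofFn_mem_graded p y hy)⟩

/-- Moving `x` past the factors that precede `y j` costs one sign for each, and these depend only on
the parities. -/
theorem exists_scalar_mul_prod_update (hC : IsSuperComm 𝒞) {d : ℕ} (i : ZMod 2)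
    (p : Fin d → ZMod 2) (j : Fin d) : ∃ ε : ℂ, ∀ x ∈ 𝒞 i, ∀ y : Fin d → C,
      (∀ j, y j ∈ 𝒞 (p j)) →
      x * (List.ofFn y).prod = ε • (List.ofFn (Function.update y j (x * y j))).prod := by
  induction d with
  | zero => exact j.elim0
  | succ d ih =>
    cases j using Fin.cases with
    | zero =>
      refine ⟨1, fun x _ y _ => ?_⟩
      simp [List.ofFn_succ, mul_assoc]
    | succ j =>
      obtain ⟨ε, hε⟩ := ih (fun k => p k.succ) j
      obtain ⟨δ, hδ⟩ := hC.exists_scalar_mul_comm i (p 0)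
      refine ⟨δ * ε, fun x hx y hy => ?_⟩
      have h := hε x hx (fun k => y k.succ) fun k => hy _
      have hup : (fun k : Fin d => Function.update y j.succ (x * y j.succ) k.succ) =
          Function.update (fun k => y k.succ) j (x * y j.succ) := by
        ext k
        simp [Function.update_apply]
      rw [List.ofFn_succ, List.ofFn_succ, List.prod_cons, List.prod_cons, hup, ← mul_assoc,
        hδ x hx _ (hy 0), Function.update_of_ne (Fin.succ_ne_zero j).symm, smul_mul_assoc,
        mul_assoc, h, mul_smul_comm, smul_smul]

end IsSuperComm

/-! ### Contractions along permutations as traces and monomials -/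

section Contraction

variable (n e f : ℕ)

/-- The algebra generated by the traces of the monomials in the generic matrices. -/
def traceSubalgebra : Subalgebra ℂ (InvAmbient n e f) :=
  Algebra.adjoin ℂ (Set.range fun w : List (Fin e ⊕ Fin f) => (genericMonomial n e f w).trace)

/-- The span of the monomials in the generic matrices over the algebra generated by their traces. -/
def traceMonomialSpan : Submodule ℂ (Matrix (Fin n) (Fin n) (InvAmbient n e f)) :=
  Submodule.span ℂ {M | ∃ t ∈ traceSubalgebra n e f, ∃ w : List (Fin e ⊕ Fin f),
    M = Matrix.scalar (Fin n) t * genericMonomial n e f w}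

variable {n e f}

theorem trace_genericMonomial_mem (w : List (Fin e ⊕ Fin f)) :
    (genericMonomial n e f w).trace ∈ traceSubalgebra n e f :=
  Algebra.subset_adjoin ⟨w, rfl⟩

theorem genericMonomial_append (v w : List (Fin e ⊕ Fin f)) :
    genericMonomial n e f (v ++ w) = genericMonomial n e f v * genericMonomial n e f w := by
  simp [genericMonomial]

theorem one_mem_traceMonomialSpan : 1 ∈ traceMonomialSpan n e f :=
  Submodule.subset_span ⟨1, one_mem _, [], by simp [genericMonomial]⟩

theorem scalar_mul_mem_traceMonomialSpan {t : InvAmbient n e f} (ht : t ∈ traceSubalgebra n e f)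
    {N : Matrix (Fin n) (Fin n) (InvAmbient n e f)} (hN : N ∈ traceMonomialSpan n e f) :
    Matrix.scalar (Fin n) t * N ∈ traceMonomialSpan n e f := by
  induction hN using Submodule.span_induction with
  | zero => simp
  | add X Y _ _ hX hY => rw [mul_add]; exact add_mem hX hY
  | smul c X _ hX => rw [mul_smul_comm]; exact Submodule.smul_mem _ _ hX
  | mem X hX =>
    obtain ⟨t', ht', w, rfl⟩ := hX
    exact Submodule.subset_span ⟨t * t', mul_mem ht ht', w, by rw [map_mul, mul_assoc]⟩

/-- The coefficients stand on the left, so right multiplication only lengthens the word and produces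
no sign. -/
theorem mul_genericMonomial_mem_traceMonomialSpan (w : List (Fin e ⊕ Fin f))
    {N : Matrix (Fin n) (Fin n) (InvAmbient n e f)} (hN : N ∈ traceMonomialSpan n e f) :
    N * genericMonomial n e f w ∈ traceMonomialSpan n e f := by
  induction hN using Submodule.span_induction with
  | zero => simp
  | add X Y _ _ hX hY => rw [add_mul]; exact add_mem hX hY
  | smul c X _ hX => rw [smul_mul_assoc]; exact Submodule.smul_mem _ _ hX
  | mem X hX =>
    obtain ⟨t, ht, v, rfl⟩ := hX
    exact Submodule.subset_span ⟨t, ht, v ++ w, by rw [genericMonomial_append, mul_assoc]⟩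

theorem trace_mem_of_mem_traceMonomialSpan
    {N : Matrix (Fin n) (Fin n) (InvAmbient n e f)} (hN : N ∈ traceMonomialSpan n e f) :
    N.trace ∈ traceSubalgebra n e f := by
  induction hN using Submodule.span_induction with
  | zero => rw [Matrix.trace_zero]; exact zero_mem _
  | add X Y _ _ hX hY => rw [Matrix.trace_add]; exact add_mem hX hY
  | smul c X _ hX => rw [Matrix.trace_smul]; exact Subalgebra.smul_mem _ hX _
  | mem X hX =>
    obtain ⟨t, ht, w, rfl⟩ := hX
    rw [Matrix.trace_scalar_mul]
    exact mul_mem ht (trace_genericMonomial_mem w)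

/-- Contracting a product of entries of monomials along a permutation, with one slot left open,
gives a combination of monomials whose coefficients are products of traces. -/
theorem exists_contraction_eq (d : ℕ) (w : Fin d → List (Fin e ⊕ Fin f))
    (τ : Equiv.Perm (Fin (d + 1))) :
    ∃ N ∈ traceMonomialSpan n e f, ∀ Z : Matrix (Fin n) (Fin n) (InvAmbient n e f),
      ∑ h : Fin (d + 1) → Fin n, (List.ofFn fun i : Fin d =>
        genericMonomial n e f (w i) (h (τ i.castSucc)) (h i.castSucc)).prod *
          Z (h (τ (Fin.last d))) (h (Fin.last d)) = ∑ a, (N * Z) a a := by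
  have hC := SuperSym.isSuperComm (Module.Dual ℂ (MatTuple n e)) (Module.Dual ℂ (MatTuple n f))
  induction d with
  | zero =>
    refine ⟨1, one_mem_traceMonomialSpan, fun Z => ?_⟩
    obtain rfl : τ = 1 := Equiv.ext fun x => Subsingleton.elim (α := Fin 1) _ _
    rw [one_mul, ← (Equiv.funUnique (Fin 1) (Fin n)).sum_comp]
    simp
  | succ d ih =>
    -- Slot `0` is removed from its cycle: `p` is the image of `0`, and `σ` is the permutation of
    -- the remaining slots. The three cases say which slot precedes `0`. The arbitrary `Z` in the
    -- open slot is what allows the induction to absorb a factor there.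
    obtain ⟨⟨p, σ⟩, rfl⟩ := Equiv.Perm.decomposeFin.symm.surjective τ
    have hsum : ∀ F : (Fin (d + 2) → Fin n) → InvAmbient n e f,
        ∑ h, F h = ∑ h : Fin (d + 1) → Fin n, ∑ a, F (Fin.cons a h) := by
      intro F
      rw [← (Fin.consEquiv fun _ => Fin n).sum_comp, Fintype.sum_prod_type, Finset.sum_comm]
      rfl
    cases p using Fin.cases with
    | zero =>
      -- Slot `0` is a fixed point and splits off as a trace.
      obtain ⟨N, hN, hNZ⟩ := ih (fun i => w i.succ) σ
      refine ⟨Matrix.scalar (Fin n) (genericMonomial n e f (w 0)).trace * N,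
        scalar_mul_mem_traceMonomialSpan (trace_genericMonomial_mem _) hN, fun Z => ?_⟩
      rw [hsum]
      simp only [List.ofFn_succ, List.prod_cons, Fin.castSucc_zero, Fin.castSucc_succ,
        ← Fin.succ_last, Equiv.Perm.decomposeFin_symm_apply_zero,
        Equiv.Perm.decomposeFin_symm_apply_succ, Equiv.swap_self, Equiv.refl_apply, Fin.cons_zero,
        Fin.cons_succ, mul_assoc, ← Finset.sum_mul, ← Finset.mul_sum, hNZ]
      exact (Matrix.trace_scalar_mul _ _).symm
    | succ j =>
      obtain ⟨i, rfl⟩ := σ.surjective j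
      cases i using Fin.lastCases with
      | last =>
        -- The open slot is mapped to `0`. The monomial of `w 0` is moved past the other factors and
        -- multiplied into `Z`.
        obtain ⟨N, hN, hNZ⟩ := ih (fun i => w i.succ) σ
        obtain ⟨ε, hε⟩ := hC.exists_scalar_mul_prod_comm
          (wordParity e f (FreeAddMonoid.ofList (w 0)))
          (fun i : Fin d => wordParity e f (FreeAddMonoid.ofList (w i.succ)))
        refine ⟨ε • (N * genericMonomial n e f (w 0)),
          Submodule.smul_mem _ _ (mul_genericMonomial_mem_traceMonomialSpan _ hN), fun Z => ?_⟩
        rw [hsum]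
        have := hNZ (genericMonomial n e f (w 0) * Z)
        rw [Matrix.smul_mul, mul_assoc]
        simp only [Matrix.smul_apply]
        rw [← Finset.smul_sum, ← this, Finset.smul_sum]
        refine Finset.sum_congr rfl fun h _ => ?_
        rw [Matrix.mul_apply, Finset.mul_sum, Finset.smul_sum]
        refine Finset.sum_congr rfl fun a _ => ?_
        have hne : ∀ k : Fin d, Equiv.swap 0 (σ (Fin.last d)).succ (σ k.castSucc).succ =
            (σ k.castSucc).succ := fun k => Equiv.swap_apply_of_ne_of_ne (Fin.succ_ne_zero _)
          fun hk => (Fin.castSucc_lt_last k).ne (σ.injective (Fin.succ_injective _ hk))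
        simp only [List.ofFn_succ, List.prod_cons, Fin.castSucc_zero, Fin.castSucc_succ,
          ← Fin.succ_last, Equiv.Perm.decomposeFin_symm_apply_zero,
          Equiv.Perm.decomposeFin_symm_apply_succ, Fin.cons_zero, Fin.cons_succ, hne,
          Equiv.swap_apply_right]
        rw [hε _ (genericMonomial_mem n e f _ _ _) _ fun k => genericMonomial_mem n e f _ _ _,
          smul_mul_assoc, mul_assoc]
      | cast i =>
        -- The slot `i.succ` is mapped to `0`. Summing over the index at `0` multiplies the two
        -- matrices, so their words are concatenated.
        obtain ⟨N, hN, hNZ⟩ := ih (Function.update (fun k => w k.succ) i (w 0 ++ w i.succ)) σ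
        obtain ⟨ε, hε⟩ := hC.exists_scalar_mul_prod_update
          (wordParity e f (FreeAddMonoid.ofList (w 0)))
          (fun i : Fin d => wordParity e f (FreeAddMonoid.ofList (w i.succ))) i
        refine ⟨ε • N, Submodule.smul_mem _ _ hN, fun Z => ?_⟩
        rw [hsum, Matrix.smul_mul]
        simp only [Matrix.smul_apply]
        rw [← Finset.smul_sum, ← hNZ, Finset.smul_sum]
        refine Finset.sum_congr rfl fun h _ => ?_
        have hne : Equiv.swap 0 (σ i.castSucc).succ (σ (Fin.last d)).succ =
            (σ (Fin.last d)).succ := Equiv.swap_apply_of_ne_of_ne (Fin.succ_ne_zero _)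
          fun hk => (Fin.castSucc_lt_last i).ne' (σ.injective (Fin.succ_injective _ hk))
        have hup : (fun k : Fin d => genericMonomial n e f
            (Function.update (fun k => w k.succ) i (w 0 ++ w i.succ) k) (h (σ k.castSucc))
            (h k.castSucc)) = Function.update (fun k => genericMonomial n e f (w k.succ)
              (h (σ k.castSucc)) (h k.castSucc)) i
              (∑ a, genericMonomial n e f (w 0) (h (σ i.castSucc)) a *
                genericMonomial n e f (w i.succ) a (h i.castSucc)) := by
          ext k
          by_cases hk : k = i
          · subst hk
            simp only [Function.update_self, genericMonomial_append, Matrix.mul_apply]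
          · simp only [Function.update_of_ne hk]
        rw [hup, List.prod_ofFn_update_sum, Finset.sum_mul, Finset.smul_sum]
        refine Finset.sum_congr rfl fun a _ => ?_
        have hfun : (fun k : Fin d => genericMonomial n e f (w k.succ)
            ((Fin.cons a h : Fin (d + 2) → Fin n)
              (Equiv.swap 0 (σ i.castSucc).succ (σ k.castSucc).succ)) (h k.castSucc)) =
            Function.update (fun k => genericMonomial n e f (w k.succ)
              (h (σ k.castSucc)) (h k.castSucc)) i
              (genericMonomial n e f (w i.succ) a (h i.castSucc)) := by
          ext k
          by_cases hk : k = i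
          · subst hk
            simp
          · rw [Function.update_of_ne hk, Equiv.swap_apply_of_ne_of_ne (Fin.succ_ne_zero _)
              fun hk' => hk (Fin.castSucc_injective _ (σ.injective (Fin.succ_injective _ hk'))),
              Fin.cons_succ]
        simp only [List.ofFn_succ, List.prod_cons, Fin.castSucc_zero, Fin.castSucc_succ,
          ← Fin.succ_last, Equiv.Perm.decomposeFin_symm_apply_zero,
          Equiv.Perm.decomposeFin_symm_apply_succ, Fin.cons_zero, Fin.cons_succ, hne, hfun]
        rw [hε _ (genericMonomial_mem n e f _ _ _), Function.update_self, Function.update_idem,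
          smul_mul_assoc]
        intro k
        by_cases hk : k = i
        · subst hk
          rw [Function.update_self]
          exact genericMonomial_mem n e f _ _ _
        · rw [Function.update_of_ne hk]
          exact genericMonomial_mem n e f _ _ _

end Contraction

/-! ### Generation by matrix entries in a common degree -/

theorem SuperSym.adjoin_eq_top (W₀ W₁ : Type*) [AddCommGroup W₀] [Module ℂ W₀]
    [AddCommGroup W₁] [Module ℂ W₁] :
    Algebra.adjoin ℂ (Set.range (SuperSym.ιEven W₀ W₁) ∪ Set.range (SuperSym.ιOdd W₀ W₁)) = ⊤ := by
  set 𝔸 := Algebra.adjoin ℂ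
    (Set.range (SuperSym.ιEven W₀ W₁) ∪ Set.range (SuperSym.ιOdd W₀ W₁))
  refine eq_top_iff.2 fun x _ => ?_
  have h0 : ∀ s : SymmetricAlgebra ℂ W₀, (Algebra.TensorProduct.includeLeft : _ →ₐ[ℂ]
      SuperSym W₀ W₁) s ∈ 𝔸 := by
    intro s
    induction s using SymmetricAlgebra.induction with
    | algebraMap r => rw [AlgHom.commutes]; exact 𝔸.algebraMap_mem r
    | ι w => exact Algebra.subset_adjoin (Or.inl ⟨w, rfl⟩)
    | mul a b ha hb => rw [map_mul]; exact mul_mem ha hb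
    | add a b ha hb => rw [map_add]; exact add_mem ha hb
  have h1 : ∀ l : ExteriorAlgebra ℂ W₁, (Algebra.TensorProduct.includeRight : _ →ₐ[ℂ]
      SuperSym W₀ W₁) l ∈ 𝔸 := by
    intro l
    induction l using ExteriorAlgebra.induction with
    | algebraMap r => rw [AlgHom.commutes]; exact 𝔸.algebraMap_mem r
    | ι w => exact Algebra.subset_adjoin (Or.inr ⟨w, rfl⟩)
    | mul a b ha hb => rw [map_mul]; exact mul_mem ha hb
    | add a b ha hb => rw [map_add]; exact add_mem ha hb
  induction x using TensorProduct.induction_on with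
  | zero => exact zero_mem _
  | add x y hx hy => exact add_mem (hx trivial) (hy trivial)
  | tmul s l => simpa using mul_mem (h0 s) (h1 l)

/-- Since `1 ∈ X`, the powers of the span of `X` increase, so products can be padded to any larger
length. This allows one tensor degree for all entries of a matrix. -/
theorem Algebra.exists_mem_span_prod_ofFn {R A : Type*} [CommSemiring R] [Semiring A] [Algebra R A]
    {X : Set A} (h1 : 1 ∈ X) {s : A} (hs : s ∈ Algebra.adjoin R X) :
    ∃ d₀ : ℕ, ∀ d, d₀ ≤ d →
      s ∈ Submodule.span R {x | ∃ y : Fin d → X, (List.ofFn fun i => (y i : A)).prod = x} := by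
  have hpow : ∀ d : ℕ, Submodule.span R {x | ∃ y : Fin d → X,
      (List.ofFn fun i => (y i : A)).prod = x} = Submodule.span R X ^ d := by
    intro d
    rw [Submodule.span_pow]
    congr 1
    ext x
    rw [Set.mem_pow]
    rfl
  have hmono : ∀ {c d : ℕ}, c ≤ d → Submodule.span R X ^ c ≤ Submodule.span R X ^ d := fun h =>
    pow_le_pow_right' (Submodule.one_le.2 (Submodule.subset_span h1)) h
  suffices h : ∃ d : ℕ, s ∈ Submodule.span R X ^ d by
    obtain ⟨d₀, h⟩ := h
    exact ⟨d₀, fun d hd => hpow d ▸ hmono hd h⟩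
  induction hs using Algebra.adjoin_induction with
  | mem x hx => exact ⟨1, by rw [pow_one]; exact Submodule.subset_span hx⟩
  | algebraMap r => exact ⟨0, by rw [pow_zero]; exact Submodule.algebraMap_mem r⟩
  | add x y _ _ hx hy =>
    obtain ⟨c, hc⟩ := hx
    obtain ⟨d, hd⟩ := hy
    exact ⟨c + d, add_mem (hmono (Nat.le_add_right c d) hc) (hmono (Nat.le_add_left d c) hd)⟩
  | mul x y _ _ hx hy =>
    obtain ⟨c, hc⟩ := hx
    obtain ⟨d, hd⟩ := hy
    exact ⟨c + d, by rw [pow_add]; exact Submodule.mul_mem_mul hc hd⟩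

section Entries

variable {n e f : ℕ}

theorem dual_eq_sum_coordFun {m : ℕ} (φ : Module.Dual ℂ (MatTuple n m)) :
    φ = ∑ i, ∑ h, ∑ k, φ (Pi.single i (Matrix.single h k 1)) • coordFun i h k := by
  refine LinearMap.pi_ext' fun i => Matrix.ext_linearMap _ fun h k => LinearMap.ext_ring ?_
  simp [coordFun, Pi.single_apply, Matrix.single_apply, apply_ite,
    ite_and, Finset.sum_ite_irrel]

/-- The entries of the generic matrices and of the identity matrix. -/
def entrySet (n e f : ℕ) : Set (InvAmbient n e f) :=
  Set.range fun q : Option (Fin e ⊕ Fin f) × Fin n × Fin n =>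
    genericMonomial n e f q.1.toList q.2.1 q.2.2

theorem genericMatrix_mem_entrySet (x : Fin e ⊕ Fin f) (h k : Fin n) :
    genericMatrix n e f x h k ∈ entrySet n e f :=
  ⟨(some x, h, k), by simp [genericMonomial]⟩

theorem one_mem_entrySet (hn : 0 < n) : 1 ∈ entrySet n e f :=
  ⟨(none, ⟨0, hn⟩, ⟨0, hn⟩), by simp [genericMonomial]⟩

theorem adjoin_entrySet_eq_top : Algebra.adjoin ℂ (entrySet n e f) = ⊤ := by
  rw [← top_le_iff, ← SuperSym.adjoin_eq_top, Algebra.adjoin_le_iff]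
  rintro _ (⟨φ, rfl⟩ | ⟨φ, rfl⟩)
  · rw [dual_eq_sum_coordFun φ]
    simp only [map_sum, map_smul]
    exact sum_mem fun i _ => sum_mem fun h _ => sum_mem fun k _ => Subalgebra.smul_mem _
      (Algebra.subset_adjoin (genericMatrix_mem_entrySet (Sum.inl i) h k)) _
  · rw [dual_eq_sum_coordFun φ]
    simp only [map_sum, map_smul]
    exact sum_mem fun i _ => sum_mem fun h _ => sum_mem fun k _ => Subalgebra.smul_mem _
      (Algebra.subset_adjoin (genericMatrix_mem_entrySet (Sum.inr i) h k)) _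

/-- The matrix whose only nonzero entry is a product of entries of generic matrices, indexed by a
mixed tensor index; the last slot gives the position of the entry. -/
def slotMatrix (n e f : ℕ) {d : ℕ} (w : Fin d → Option (Fin e ⊕ Fin f))
    (h k : Fin (d + 1) → Fin n) : Matrix (Fin n) (Fin n) (InvAmbient n e f) :=
  Matrix.single (k (Fin.last d)) (h (Fin.last d)) (List.ofFn fun i =>
    genericMonomial n e f (w i).toList (h i.castSucc) (k i.castSucc)).prod

theorem exists_mem_span_slotMatrix (M : Matrix (Fin n) (Fin n) (InvAmbient n e f)) :
    ∃ d : ℕ, M ∈ Submodule.span ℂ (Set.range fun q : (Fin d → Option (Fin e ⊕ Fin f)) ×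
      (Fin (d + 1) → Fin n) × (Fin (d + 1) → Fin n) => slotMatrix n e f q.1 q.2.1 q.2.2) := by
  rcases Nat.eq_zero_or_pos n with rfl | hn
  · exact ⟨0, by rw [Subsingleton.elim M 0]; exact zero_mem _⟩
  choose D hD using fun p q => Algebra.exists_mem_span_prod_ofFn (R := ℂ) (one_mem_entrySet hn)
    (s := M p q) (adjoin_entrySet_eq_top (n := n) (e := e) (f := f) ▸ Algebra.mem_top)
  -- The sum serves only as a common upper bound of the `D p q`.
  refine ⟨∑ p, ∑ q, D p q, ?_⟩
  rw [Matrix.matrix_eq_sum_single M]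
  refine sum_mem fun p _ => sum_mem fun q _ => ?_
  have hle : D p q ≤ ∑ p, ∑ q, D p q :=
    (Finset.single_le_sum (f := fun q => D p q) (fun _ _ => Nat.zero_le _)
      (Finset.mem_univ q)).trans
    (Finset.single_le_sum (f := fun p => ∑ q, D p q) (fun _ _ => Nat.zero_le _)
      (Finset.mem_univ p))
  have hmem := hD p q _ hle
  generalize M p q = s at hmem
  generalize (∑ p, ∑ q, D p q) = d at hmem
  induction hmem using Submodule.span_induction with
  | zero => rw [Matrix.single_zero]; exact zero_mem _
  | add x y _ _ hx hy => rw [Matrix.single_add]; exact add_mem hx hy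
  | smul c x _ hx => rw [← Matrix.smul_single]; exact Submodule.smul_mem _ _ hx
  | mem x hx =>
    obtain ⟨y, rfl⟩ := hx
    choose u hu using fun i => (y i).2
    refine Submodule.subset_span ⟨(fun i => (u i).1, Fin.snoc (fun i => (u i).2.1) q,
      Fin.snoc (fun i => (u i).2.2) p), ?_⟩
    simp only [slotMatrix, Fin.snoc_last, Fin.snoc_castSucc]
    congr 3
    exact funext hu

end Entries

/-! ### The group action on entries, monomials and slots -/

section Equivariance

variable {n e f : ℕ}

theorem dualAct_coordFun {m : ℕ} (g : GL (Fin n) ℂ) (i : Fin m) (h k : Fin n) :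
    dualAct m g (coordFun i h k) = ∑ a, ∑ b,
      (((g⁻¹ : GL (Fin n) ℂ) : Matrix (Fin n) (Fin n) ℂ) h a *
        (g : Matrix (Fin n) (Fin n) ℂ) b k) • coordFun i a b := by
  refine LinearMap.ext fun A => ?_
  have : dualAct m g (coordFun i h k) A =
      (((g⁻¹ : GL (Fin n) ℂ) : Matrix (Fin n) (Fin n) ℂ) * A i *
        (g : Matrix (Fin n) (Fin n) ℂ)) h k := by
    change (((g⁻¹ : GL (Fin n) ℂ) : Matrix (Fin n) (Fin n) ℂ) * A i *
      ((g⁻¹⁻¹ : GL (Fin n) ℂ) : Matrix (Fin n) (Fin n) ℂ)) h k = _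
    rw [inv_inv]
  rw [this]
  simp only [Matrix.mul_apply, Finset.sum_mul, LinearMap.sum_apply, LinearMap.smul_apply]
  rw [Finset.sum_comm]
  refine Finset.sum_congr rfl fun a _ => Finset.sum_congr rfl fun b _ => ?_
  exact mul_right_comm _ _ _

theorem actS_genericMatrix (g : GL (Fin n) ℂ) (x : Fin e ⊕ Fin f) (h k : Fin n) :
    actS e f g (genericMatrix n e f x h k) = ∑ a, ∑ b,
      (((g⁻¹ : GL (Fin n) ℂ) : Matrix (Fin n) (Fin n) ℂ) h a *
        (g : Matrix (Fin n) (Fin n) ℂ) b k) • genericMatrix n e f x a b := by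
  cases x with
  | inl i =>
    have : actS e f g (genericMatrix n e f (Sum.inl i) h k) =
        SuperSym.ιEven _ _ (dualAct e g (coordFun i h k)) := by
      simp [actS, genericMatrix, SuperSym.ιEven]
    rw [this, dualAct_coordFun]
    simp only [map_sum, map_smul]
    rfl
  | inr i =>
    have : actS e f g (genericMatrix n e f (Sum.inr i) h k) =
        SuperSym.ιOdd _ _ (dualAct f g (coordFun i h k)) := by
      simp [actS, genericMatrix, SuperSym.ιOdd]
    rw [this, dualAct_coordFun]
    simp only [map_sum, map_smul]
    rfl

theorem constMat_mul_mul_constMat_apply (A B : Matrix (Fin n) (Fin n) ℂ)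
    (M : Matrix (Fin n) (Fin n) (InvAmbient n e f)) (h k : Fin n) :
    (constMat e f A * M * constMat e f B) h k = ∑ a, ∑ b, (A h a * B b k) • M a b := by
  simp only [Matrix.mul_apply, Finset.sum_mul]
  rw [Finset.sum_comm]
  refine Finset.sum_congr rfl fun a _ => Finset.sum_congr rfl fun b _ => ?_
  change algebraMap ℂ _ (A h a) * M a b * algebraMap ℂ _ (B b k) = _
  rw [← Algebra.smul_def, ← Algebra.commutes, ← Algebra.smul_def, smul_smul, mul_comm]

/-- It holds for each letter, and the inner factors `g g⁻¹` cancel in products. The conjugation by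
`g` in `actMat` undoes exactly this. -/
theorem mapMatrix_actS_genericMonomial (g : GL (Fin n) ℂ) (w : List (Fin e ⊕ Fin f)) :
    (actS e f g).mapMatrix (genericMonomial n e f w) =
      constMat e f ((g⁻¹ : GL (Fin n) ℂ) : Matrix (Fin n) (Fin n) ℂ) * genericMonomial n e f w *
        constMat e f (g : Matrix (Fin n) (Fin n) ℂ) := by
  induction w with
  | nil =>
    change (actS e f g).mapMatrix 1 = _ * 1 * _
    rw [map_one, mul_one, constMat_inv_mul]
  | cons x w ih =>
    have hx : (actS e f g).mapMatrix (genericMatrix n e f x) =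
        constMat e f ((g⁻¹ : GL (Fin n) ℂ) : Matrix (Fin n) (Fin n) ℂ) * genericMatrix n e f x *
          constMat e f (g : Matrix (Fin n) (Fin n) ℂ) := by
      ext h k
      rw [constMat_mul_mul_constMat_apply]
      exact actS_genericMatrix g x h k
    have hw : genericMonomial n e f (x :: w) = genericMatrix n e f x * genericMonomial n e f w := by
      simp [genericMonomial]
    have hg := constMat_mul_inv e f g
    rw [hw, map_mul, hx, ih]
    simp only [mul_assoc]
    rw [← mul_assoc (constMat e f _) (constMat e f _), hg, one_mul]

theorem actS_genericMonomial (g : GL (Fin n) ℂ) (w : List (Fin e ⊕ Fin f)) (h k : Fin n) :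
    actS e f g (genericMonomial n e f w h k) = ∑ a, ∑ b,
      (((g⁻¹ : GL (Fin n) ℂ) : Matrix (Fin n) (Fin n) ℂ) h a *
        (g : Matrix (Fin n) (Fin n) ℂ) b k) • genericMonomial n e f w a b := by
  rw [← constMat_mul_mul_constMat_apply, ← mapMatrix_actS_genericMonomial]
  rfl

theorem actMat_genericMonomial (g : GL (Fin n) ℂ) (w : List (Fin e ⊕ Fin f)) :
    actMat e f g (genericMonomial n e f w) = genericMonomial n e f w := by
  change constMat e f g * (actS e f g).mapMatrix (genericMonomial n e f w) * constMat e f _ = _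
  rw [mapMatrix_actS_genericMonomial]
  have hg := constMat_mul_inv e f g
  simp only [mul_assoc]
  rw [hg, mul_one, ← mul_assoc, hg, one_mul]

theorem trace_genericMonomial_mem_invariants (w : List (Fin e ⊕ Fin f)) :
    (genericMonomial n e f w).trace ∈ invariants n e f := by
  intro g
  simp only [Matrix.trace, Matrix.diag, map_sum, actS_genericMonomial]
  have h : ∀ a b, ∑ h, (g : Matrix (Fin n) (Fin n) ℂ) b h *
      ((g⁻¹ : GL (Fin n) ℂ) : Matrix (Fin n) (Fin n) ℂ) h a = if b = a then 1 else 0 := by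
    intro a b
    rw [← Matrix.mul_apply, Units.mul_inv, Matrix.one_apply]
  calc _ = ∑ a, ∑ b, ∑ h, (((g⁻¹ : GL (Fin n) ℂ) : Matrix (Fin n) (Fin n) ℂ) h a *
        (g : Matrix (Fin n) (Fin n) ℂ) b h) • genericMonomial n e f w a b := by
        rw [Finset.sum_comm]
        exact Finset.sum_congr rfl fun a _ => Finset.sum_comm
    _ = _ := by
        simp only [← Finset.sum_smul, mul_comm (((g⁻¹ : GL (Fin n) ℂ) : Matrix (Fin n) (Fin n) ℂ) _ _), h,
          ite_smul, one_smul, zero_smul, Finset.sum_ite_eq', Finset.mem_univ, if_true]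

theorem scalar_mem_equivariants {s : InvAmbient n e f} (hs : s ∈ invariants n e f) :
    Matrix.scalar (Fin n) s ∈ equivariants n e f := by
  intro g
  have h1 : (actS e f g).mapMatrix (Matrix.scalar (Fin n) s) = Matrix.scalar (Fin n) s := by
    ext h k
    by_cases hk : h = k
    · subst hk; simpa using hs g
    · simp [hk]
  change constMat e f g * (actS e f g).mapMatrix _ * constMat e f _ = _
  have h2 : constMat e f (g : Matrix (Fin n) (Fin n) ℂ) * Matrix.scalar (Fin n) s =
      Matrix.scalar (Fin n) s * constMat e f (g : Matrix (Fin n) (Fin n) ℂ) := by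
    ext h k
    simpa using Algebra.commutes ((g : Matrix (Fin n) (Fin n) ℂ) h k) s
  rw [h1, h2, mul_assoc, constMat_mul_inv, mul_one]

/-- The position in `slotMatrix` is transposed so that the matrix unit transforms by the same rule
as the entries. Entries of the identity obey this rule too, so padding slots need no separate
treatment. -/
theorem actMat_slotMatrix {d : ℕ} (g : GL (Fin n) ℂ) (w : Fin d → Option (Fin e ⊕ Fin f))
    (h k : Fin (d + 1) → Fin n) :
    actMat e f g (slotMatrix n e f w h k) = ∑ a, ∑ b,
      (tensorPowMatrix (d + 1) ((g⁻¹ : GL (Fin n) ℂ) : Matrix (Fin n) (Fin n) ℂ) h a *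
        tensorPowMatrix (d + 1) (g : Matrix (Fin n) (Fin n) ℂ) b k) •
          slotMatrix n e f w a b := by
  have hprod : ∀ h k : Fin d → Fin n, actS e f g (List.ofFn fun i =>
      genericMonomial n e f (w i).toList (h i) (k i)).prod = ∑ a, ∑ b,
      (tensorPowMatrix d ((g⁻¹ : GL (Fin n) ℂ) : Matrix (Fin n) (Fin n) ℂ) h a *
        tensorPowMatrix d (g : Matrix (Fin n) (Fin n) ℂ) b k) • (List.ofFn fun i =>
      genericMonomial n e f (w i).toList (a i) (b i)).prod := by
    intro h k
    let μ := MultilinearMap.mkPiAlgebraFin ℂ d (InvAmbient n e f)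
    have hμ : ∀ y, (List.ofFn y).prod = μ y := fun y => by simp [μ]
    rw [map_list_prod, List.map_ofFn]
    simp only [Function.comp_def, actS_genericMonomial, hμ, MultilinearMap.map_sum,
      MultilinearMap.map_smul_univ, tensorPowMatrix_apply, Finset.prod_mul_distrib]
  have hsum : ∀ F : (Fin (d + 1) → Fin n) → Matrix (Fin n) (Fin n) (InvAmbient n e f),
      ∑ h, F h = ∑ a, ∑ h : Fin d → Fin n, F (Fin.snoc h a) := by
    intro F
    rw [← (Fin.snocEquiv fun _ => Fin n).sum_comp, Fintype.sum_prod_type]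
    rfl
  have hsingle : ∀ (A B : Matrix (Fin n) (Fin n) ℂ) (p q : Fin n) (x : InvAmbient n e f),
      constMat e f A * Matrix.single p q x * constMat e f B =
        ∑ a, ∑ b, (A b p * B q a) • Matrix.single b a x := by
    intro A B p q x
    ext r c
    rw [constMat_mul_mul_constMat_apply]
    simp only [Matrix.sum_apply, Matrix.smul_apply, Matrix.single_apply, ite_and, smul_ite,
      smul_zero, Finset.sum_ite_eq', Finset.sum_ite_eq, Finset.sum_ite_irrel, Finset.mem_univ,
      if_true, Finset.sum_const_zero]
  have hsum_single : ∀ (p q : Fin n)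
      (F : (Fin d → Fin n) → (Fin d → Fin n) → InvAmbient n e f),
      Matrix.single p q (∑ a, ∑ b, F a b) = ∑ a, ∑ b, Matrix.single p q (F a b) := by
    intro p q F
    simp only [← Matrix.singleAddMonoidHom_apply, map_sum]
  have hact : actMat e f g (slotMatrix n e f w h k) = constMat e f (g : Matrix (Fin n) (Fin n) ℂ) *
      Matrix.single (k (Fin.last d)) (h (Fin.last d)) (actS e f g (List.ofFn fun i =>
        genericMonomial n e f (w i).toList (h i.castSucc) (k i.castSucc)).prod) *
      constMat e f ((g⁻¹ : GL (Fin n) ℂ) : Matrix (Fin n) (Fin n) ℂ) := by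
    change _ * (actS e f g).mapMatrix (Matrix.single (k (Fin.last d)) (h (Fin.last d)) _) * _ = _
    congr 2
    exact Matrix.map_single _ _ _ _
  rw [hact, hprod, hsingle, hsum]
  refine Finset.sum_congr rfl fun p _ => ?_
  simp only [hsum, hsum_single]
  simp only [Finset.smul_sum, slotMatrix, Fin.snoc_last, Fin.snoc_castSucc, tensorPowMatrix_apply,
    Fin.prod_univ_castSucc]
  rw [Finset.sum_comm]
  refine Finset.sum_congr rfl fun a _ => Finset.sum_congr rfl fun q _ =>
    Finset.sum_congr rfl fun b _ => ?_
  rw [← Matrix.smul_single, smul_smul]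
  congr 1
  ring

end Equivariance

/-! ### The fundamental theorem and the images of the evaluations -/

section FundamentalTheorem

variable (n e f : ℕ)

/-- The algebra generated by the generic matrices and the traces of their monomials. -/
def traceMatrixSubalgebra : Subalgebra ℂ (Matrix (Fin n) (Fin n) (InvAmbient n e f)) :=
  Algebra.adjoin ℂ
    ((Set.range fun w : List (Fin e ⊕ Fin f) =>
        Matrix.scalar (Fin n) (genericMonomial n e f w).trace) ∪
      Set.range (genericMatrix n e f))

variable {n e f}

/-- The hard inclusion: an equivariant matrix is a combination of contractions along permutations,
and each contraction lies in the span. -/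
theorem equivariants_le_traceMonomialSpan :
    Subalgebra.toSubmodule (equivariants n e f) ≤ traceMonomialSpan n e f := by
  intro M hM
  obtain ⟨d, hd⟩ := exists_mem_span_slotMatrix M
  have := mem_span_of_forall_GL_fixed (fun g => (actMat e f g).toLinearMap)
    (fun w h k => slotMatrix n e f w h k) (fun g w h k => actMat_slotMatrix g w h k) hd hM
  refine Submodule.span_le.2 ?_ this
  rintro _ ⟨⟨w, τ⟩, rfl⟩
  obtain ⟨N, hN, hNZ⟩ := exists_contraction_eq (n := n) d (fun i => (w i).toList) τ
  have : ∑ k, slotMatrix n e f w (k ∘ τ) k = N := by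
    ext p q
    -- A matrix unit in the open slot makes the trace read off the entry `N p q`.
    have h := hNZ (Matrix.single q p 1)
    have hr : ∑ a, (N * Matrix.single q p (1 : InvAmbient n e f) : Matrix _ _ _) a a = N p q := by
      have := Matrix.trace_mul_single N q p (1 : InvAmbient n e f)
      simpa [Matrix.trace] using this
    rw [← hr, ← h, Matrix.sum_apply]
    refine Finset.sum_congr rfl fun k _ => ?_
    simp only [slotMatrix, Matrix.single_apply, Function.comp_apply, mul_ite, mul_one, mul_zero]
    congr 1
    exact propext ⟨fun h => ⟨h.2.symm, h.1.symm⟩, fun h => ⟨h.2.symm, h.1.symm⟩⟩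
  change ∑ k, slotMatrix n e f w (k ∘ τ) k ∈ _
  rwa [this]

theorem genericMonomial_mem_traceMatrixSubalgebra (w : List (Fin e ⊕ Fin f)) :
    genericMonomial n e f w ∈ traceMatrixSubalgebra n e f := by
  refine list_prod_mem fun M hM => ?_
  obtain ⟨x, -, rfl⟩ := List.mem_map.1 hM
  exact Algebra.subset_adjoin (Or.inr ⟨x, rfl⟩)

theorem scalar_mem_traceMatrixSubalgebra {t : InvAmbient n e f} (ht : t ∈ traceSubalgebra n e f) :
    Matrix.scalar (Fin n) t ∈ traceMatrixSubalgebra n e f := by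
  have h : traceSubalgebra n e f ≤
      (traceMatrixSubalgebra n e f).comap (Matrix.scalarAlgHom (Fin n) ℂ) := by
    refine Algebra.adjoin_le ?_
    rintro _ ⟨w, rfl⟩
    exact Algebra.subset_adjoin (Or.inl ⟨w, rfl⟩)
  exact h ht

theorem traceMonomialSpan_le_traceMatrixSubalgebra :
    traceMonomialSpan n e f ≤ Subalgebra.toSubmodule (traceMatrixSubalgebra n e f) := by
  refine Submodule.span_le.2 ?_
  rintro _ ⟨t, ht, w, rfl⟩
  exact (traceMatrixSubalgebra n e f).mul_mem (scalar_mem_traceMatrixSubalgebra ht) (genericMonomial_mem_traceMatrixSubalgebra w)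

theorem traceMatrixSubalgebra_le_equivariants :
    traceMatrixSubalgebra n e f ≤ equivariants n e f := by
  refine Algebra.adjoin_le ?_
  rintro _ (⟨w, rfl⟩ | ⟨x, rfl⟩)
  · exact scalar_mem_equivariants (trace_genericMonomial_mem_invariants w)
  · intro g
    simpa [genericMonomial] using actMat_genericMonomial g [x]

/-- The equivariant maps are generated by the generic matrices and the traces of monomials. -/
theorem traceMatrixSubalgebra_eq_equivariants :
    traceMatrixSubalgebra n e f = equivariants n e f :=
  le_antisymm traceMatrixSubalgebra_le_equivariants fun _ hM =>
    traceMonomialSpan_le_traceMatrixSubalgebra (equivariants_le_traceMonomialSpan hM)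

/-- The invariants are generated by the traces of monomials. -/
theorem traceSubalgebra_eq_invariants : traceSubalgebra n e f = invariants n e f := by
  refine le_antisymm (Algebra.adjoin_le ?_) fun s hs => ?_
  · rintro _ ⟨w, rfl⟩
    exact trace_genericMonomial_mem_invariants w
  rcases Nat.eq_zero_or_pos n with rfl | hn
  -- For `n = 0` one cannot divide by `n`, but there are no coordinates and `S` consists of scalars.
  · have htop : Algebra.adjoin ℂ (entrySet 0 e f) = ⊤ := adjoin_entrySet_eq_top
    have hempty : entrySet 0 e f = ∅ := Set.range_eq_empty _
    rw [hempty, Algebra.adjoin_empty] at htop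
    have : s ∈ (⊥ : Subalgebra ℂ (InvAmbient 0 e f)) := htop ▸ Algebra.mem_top
    exact bot_le (a := traceSubalgebra 0 e f) this
  · have h := trace_mem_of_mem_traceMonomialSpan
      (equivariants_le_traceMonomialSpan (scalar_mem_equivariants hs))
    have htr : (Matrix.scalar (Fin n) s).trace = (n : ℂ) • s := by
      rw [Nat.cast_smul_eq_nsmul]
      simp [Matrix.trace]
    rw [htr] at h
    have hn' : (n : ℂ) ≠ 0 := Nat.cast_ne_zero.2 hn.ne'
    have := Subalgebra.smul_mem _ h (n : ℂ)⁻¹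
    rwa [smul_smul, inv_mul_cancel₀ hn', one_smul] at this

theorem evalFree_single (w : FreeAddMonoid (Fin e ⊕ Fin f)) :
    evalFree n e f (AddMonoidAlgebra.single w 1) = genericMonomial n e f w.toList := by
  simp [evalFree]
  rfl

theorem evalFree_mem_span (a : FreeSuperAlg e f) :
    evalFree n e f a ∈ Submodule.span ℂ (Set.range (genericMonomial n e f)) := by
  rw [evalFree, AddMonoidAlgebra.lift_apply, Finsupp.sum]
  exact Submodule.sum_mem _ fun w _ =>
    Submodule.smul_mem _ _ (Submodule.subset_span ⟨w.toList, rfl⟩)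

theorem trace_evalFree_mem (a : FreeSuperAlg e f) :
    (evalFree n e f a).trace ∈ traceSubalgebra n e f := by
  have h : Submodule.span ℂ (Set.range (genericMonomial n e f)) ≤
      (Subalgebra.toSubmodule (traceSubalgebra n e f)).comap
        (Matrix.traceLinearMap (Fin n) ℂ (InvAmbient n e f)) := by
    refine Submodule.span_le.2 ?_
    rintro _ ⟨w, rfl⟩
    exact trace_genericMonomial_mem w
  exact h (evalFree_mem_span a)

theorem evalGenericTrace_formalTrace (a : FreeSuperAlg e f) :
    evalGenericTrace n e f (formalTrace (freeGrading e f) a) = (evalFree n e f a).trace :=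
  evalTraceAlg_formalTrace _ _ _ a

/-- The generators of the trace algebra are classes of elements of the free algebra, whose
evaluations are combinations of monomials. -/
theorem range_evalGenericTrace : (evalGenericTrace n e f).range = traceSubalgebra n e f := by
  refine le_antisymm ?_ (Algebra.adjoin_le ?_)
  · rw [← Algebra.map_top, ← SuperSym.adjoin_eq_top, AlgHom.map_adjoin, Algebra.adjoin_le_iff]
    rintro _ ⟨_, ⟨c, rfl⟩ | ⟨c, rfl⟩, rfl⟩
    · obtain ⟨a, rfl⟩ := Submodule.mkQ_surjective _ c
      have : evalGenericTrace n e f (SuperSym.ιEven _ _ (Submodule.mkQ _ a)) =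
        (evalFree n e f a).trace := SuperSym.lift_ιEven _ _ _ _
      exact this ▸ trace_evalFree_mem _
    · obtain ⟨a, rfl⟩ := Submodule.mkQ_surjective _ c
      have : evalGenericTrace n e f (SuperSym.ιOdd _ _ (Submodule.mkQ _ a)) =
        (evalFree n e f a).trace := SuperSym.lift_ιOdd _ _ _ _
      exact this ▸ trace_evalFree_mem _
  · rintro _ ⟨w, rfl⟩
    exact ⟨formalTrace (freeGrading e f) (AddMonoidAlgebra.single (FreeAddMonoid.ofList w) 1),
      (evalGenericTrace_formalTrace _).trans (by rw [evalFree_single]; rfl)⟩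

theorem range_evalGeneric : (evalGeneric n e f).range = traceMatrixSubalgebra n e f := by
  have hE : ∀ c, evalGeneric n e f (WithTrace.ofTraceAlg _ c) =
      Matrix.scalar (Fin n) (evalGenericTrace n e f c) := evalWithTrace_ofTraceAlg _ _ _
  have hF : ∀ a, evalGeneric n e f (WithTrace.of _ a) = evalFree n e f a :=
    evalWithTrace_of _ _ _
  refine le_antisymm ?_ (Algebra.adjoin_le ?_)
  · rintro _ ⟨x, rfl⟩
    -- The graded tensor product differs from the ordinary one only in its multiplication, so pure
    -- tensors span it.
    change TensorProduct ℂ (FreeSuperAlg e f) (FreeTraceAlg e f) at x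
    change evalGeneric n e f x ∈ traceMatrixSubalgebra n e f
    induction x using TensorProduct.induction_on with
    | zero => exact (map_zero (evalGeneric n e f)).symm ▸ zero_mem _
    | add x y hx hy => exact (map_add (evalGeneric n e f) x y).symm ▸ add_mem hx hy
    | tmul a c =>
      have h : evalFree n e f a * Matrix.scalar (Fin n) (evalGenericTrace n e f c) ∈
          traceMatrixSubalgebra n e f := by
        refine mul_mem ?_ (scalar_mem_traceMatrixSubalgebra ?_)
        · have : Submodule.span ℂ (Set.range (genericMonomial n e f)) ≤
              Subalgebra.toSubmodule (traceMatrixSubalgebra n e f) := by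
            refine Submodule.span_le.2 ?_
            rintro _ ⟨w, rfl⟩
            exact genericMonomial_mem_traceMatrixSubalgebra w
          exact this (evalFree_mem_span a)
        · rw [← range_evalGenericTrace]
          exact ⟨c, rfl⟩
      exact h
  · rintro _ (⟨w, rfl⟩ | ⟨x, rfl⟩)
    · obtain ⟨c, hc⟩ : (genericMonomial n e f w).trace ∈ (evalGenericTrace n e f).range :=
        range_evalGenericTrace ▸ trace_genericMonomial_mem w
      exact ⟨_, (hE c).trans (congrArg _ hc)⟩
    · exact ⟨_, (hF (AddMonoidAlgebra.single (FreeAddMonoid.of x) 1)).trans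
        ((evalFree_single _).trans (by simp [genericMonomial]))⟩

end FundamentalTheorem

end

theorem mainTheorem2 (n e f : ℕ) :
    -- the evaluation of the free superalgebra with trace surjects onto the invariants
    (evalGeneric n e f).range = equivariants n e f ∧
    (evalGenericTrace n e f).range = invariants n e f ∧
    -- the invariants are generated by the traces of monomials in the generic matrices
    Algebra.adjoin ℂ (Set.range fun w : List (Fin e ⊕ Fin f) => (genericMonomial n e f w).trace) =
      invariants n e f ∧
    -- the equivariant maps are generated by these traces and by the generic matrices
    Algebra.adjoin ℂ
      ((Set.range fun w : List (Fin e ⊕ Fin f) =>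
          Matrix.scalar (Fin n) (genericMonomial n e f w).trace) ∪
        Set.range (genericMatrix n e f)) = equivariants n e f :=
  ⟨range_evalGeneric.trans traceMatrixSubalgebra_eq_equivariants,
    range_evalGenericTrace.trans traceSubalgebra_eq_invariants,
    traceSubalgebra_eq_invariants, traceMatrixSubalgebra_eq_equivariants⟩
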